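/- Let $V$ be a nonempty countable set, $\mathcal E : V\times V\to[0,\infty)$ symmetric and locally finite (for each $x$ only finitely many $y$ have $\mathcal E(x,y)>0$; such $y$ are the neighbours of $x$, written $y\sim x$), and $m:V\to(0,\infty)$; assume that every connected component of the weighted graph $(V,\mathcal E,m)$ is infinite. Let $\Delta_m$ be the Laplacian of the graph, i.e. the Friedrichs extension in $\ell^2(V,m)$ of $$f\mapsto \frac1{m(x)}\sum_{y\in V}\mathcal E(x,y)\,(f(x)-f(y)),\qquad f\in C_c(V),$$ where $C_c(V)$ denotes the finitely supported functions $V\to\mathbb C$; write $\mathcal D(\Delta_m^{1/2})$ for its form domain. Suppose that there is a $1$-dimensional decomposition of the graph, i.e. a partition $V=\bigsqcup_{n\ge0}S_n$ into finite sets such that $\mathcal E(x,y)>0$, $x\in S_n$, $y\in S_k$ imply $|n-k|\le 1$. Write $|x|=n$ for $x\in S_n$, put $$\deg_\pm(x)=\frac1{m(x)}\sum_{y:\,|y|=|x|\pm1}\mathcal E(x,y),\qquad \deg_0(x)=\frac1{m(x)}\sum_{y:\,|y|=|x|}\mathcal E(x,y),$$ $\deg(x)=\deg_+(x)+\deg_0(x)+\deg_-(x)=\frac1{m(x)}\sum_{y}\mathcal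 E(x,y)$, and let $q(\cdot)$ denote the operator of multiplication by a function $q$ in $\ell^2(V,m)$, on its maximal domain. Assume that, as $|x|\to\infty$, $$\deg_+(x)\to\infty\qquad\text{and}\qquad \max(\deg_-(x),\deg_0(x))=o(\deg_+(x)).$$ Then $\mathcal D(\Delta_m^{1/2})=\mathcal D(\deg^{1/2}(\cdot))$, the essential spectrum of $\Delta_m$ is empty, and $$\lim_{n\to\infty}\frac{\lambda_n(\Delta_m)}{\lambda_n(\deg(\cdot))}=1,$$ where $\lambda_1(A)\le\lambda_2(A)\le\cdots$ denote the eigenvalues of $A$ below its essential spectrum, repeated according to multiplicity (for both operators this sequence exists and is infinite). -/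

import Mathlib

open Filter Topology Asymptotics
open scoped ComplexConjugate

/- Make `inner ℂ x y` elaborate to the inner product of the inner product space itself, instead of
the definitionally equal one that comes from viewing the space as a C⋆-module over `ℂ`. -/
attribute [-instance] WithCStarModule.instCStarModuleComplex

noncomputable section

/-! ### Unbounded operators on a complex Hilbert space -/

namespace LinearPMap

variable {E : Type*} [NormedAddCommGroup E] [InnerProductSpace ℂ E]

/-- The quadratic form `x ↦ re ⟪x, A x⟫` of an operator `A`, on the domain of `A`. -/
def quadForm (A : E →ₗ.[ℂ] E) (x : A.domain) : ℝ := (inner ℂ (x : E) (A x)).re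

/-- `A` is non-negative: `0 ≤ re ⟪x, A x⟫` on the domain of `A`. -/
def IsNonneg (A : E →ₗ.[ℂ] E) : Prop := ∀ x : A.domain, 0 ≤ A.quadForm x

/-- The form domain of a non-negative symmetric operator `A`, as a set of vectors: the completion,
inside the Hilbert space, of the domain of `A` for the norm `(⟪x, A x⟫ + ‖x‖ ^ 2) ^ (1 / 2)`.
A vector belongs to it iff it is the limit of a sequence in the domain of `A` which is a Cauchy
sequence for that norm. For self-adjoint `A` this is the domain of `A ^ (1 / 2)`. -/
def formDomain (A : E →ₗ.[ℂ] E) : Set E :=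
  {f | ∃ φ : ℕ → A.domain, Tendsto (fun n => (φ n : E)) atTop (𝓝 f) ∧
    Tendsto (fun p : ℕ × ℕ => A.quadForm (φ p.1 - φ p.2)) atTop (𝓝 0)}

theorem quadForm_parallelogram (A : E →ₗ.[ℂ] E) (x y : A.domain) :
    A.quadForm (x + y) + A.quadForm (x - y) = 2 * A.quadForm x + 2 * A.quadForm y := by
  simp only [quadForm, LinearPMap.map_add, LinearPMap.map_sub, Submodule.coe_add,
    Submodule.coe_sub, inner_add_left, inner_add_right, inner_sub_left, inner_sub_right,
    Complex.add_re, Complex.sub_re]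
  ring

theorem quadForm_smul (A : E →ₗ.[ℂ] E) (c : ℂ) (x : A.domain) :
    A.quadForm (c • x) = ‖c‖ ^ 2 * A.quadForm x := by
  simp only [quadForm, LinearPMap.map_smul, Submodule.coe_smul, inner_smul_left, inner_smul_right]
  rw [← mul_assoc, mul_comm c, Complex.conj_mul', ← Complex.ofReal_pow, Complex.re_ofReal_mul]

/-- The form domain of a non-negative operator is a linear subspace. -/
def formSubmodule (A : E →ₗ.[ℂ] E) (hA : A.IsNonneg) : Submodule ℂ E where
  carrier := A.formDomain
  zero_mem' := ⟨fun _ => 0, by simp, by simp [quadForm]⟩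
  add_mem' := by
    rintro f g ⟨φ, hφ, hφ'⟩ ⟨ψ, hψ, hψ'⟩
    refine ⟨fun n => φ n + ψ n, by simpa using hφ.add hψ, ?_⟩
    have h := (hφ'.const_mul 2).add (hψ'.const_mul 2)
    simp only [mul_zero, add_zero] at h
    refine squeeze_zero (fun p => hA _) (fun p => ?_) h
    have e : φ p.1 + ψ p.1 - (φ p.2 + ψ p.2) = (φ p.1 - φ p.2) + (ψ p.1 - ψ p.2) := by abel
    have h1 := A.quadForm_parallelogram (φ p.1 - φ p.2) (ψ p.1 - ψ p.2)
    have h2 := hA ((φ p.1 - φ p.2) - (ψ p.1 - ψ p.2))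
    rw [e]
    linarith
  smul_mem' := by
    rintro c f ⟨φ, hφ, hφ'⟩
    refine ⟨fun n => c • φ n, by simpa using hφ.const_smul c, ?_⟩
    have h := hφ'.const_mul (‖c‖ ^ 2)
    simpa only [← smul_sub, quadForm_smul, mul_zero] using h

/-- The Friedrichs extension of a densely defined non-negative symmetric operator `A`: the
restriction of the adjoint of `A` to the intersection of its domain with the form domain of `A`. -/
def friedrichs [CompleteSpace E] (A : E →ₗ.[ℂ] E) (hA : A.IsNonneg) : E →ₗ.[ℂ] E :=
  A.adjoint.domRestrict (A.formSubmodule hA)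

/-- The resolvent set: those `z` for which `A - z` is a bijection from the domain of `A` onto the
space with a bounded inverse `R`. -/
def resolvents (A : E →ₗ.[ℂ] E) : Set ℂ :=
  {z | ∃ R : E →L[ℂ] E,
    (∀ y : E, ∃ h : R y ∈ A.domain, A ⟨R y, h⟩ - z • R y = y) ∧
    ∀ x : A.domain, R (A x - z • (x : E)) = x}

/-- The spectrum `σ(A)`. -/
def opSpectrum (A : E →ₗ.[ℂ] E) : Set ℂ := A.resolventsᶜ

/-- The eigenspace `ker (A - z)`. -/
def eigenspace (A : E →ₗ.[ℂ] E) (z : ℂ) : Submodule ℂ E where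
  carrier := {f | ∃ h : f ∈ A.domain, A ⟨f, h⟩ = z • f}
  zero_mem' := ⟨A.domain.zero_mem, by
    rw [smul_zero]
    exact A.map_zero⟩
  add_mem' := by
    rintro f g ⟨hf, hf'⟩ ⟨hg, hg'⟩
    refine ⟨A.domain.add_mem hf hg, ?_⟩
    rw [smul_add, ← hf', ← hg', ← A.map_add]
    rfl
  smul_mem' := by
    rintro c f ⟨hf, hf'⟩
    refine ⟨A.domain.smul_mem c hf, ?_⟩
    rw [smul_comm, ← hf', ← A.map_smul]
    rfl

/-- The discrete spectrum: isolated points of the spectrum which are eigenvalues of finite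
multiplicity. -/
def discreteSpectrum (A : E →ₗ.[ℂ] E) : Set ℂ :=
  {z | z ∈ A.opSpectrum ∧ (∃ ε > 0, ∀ w ∈ A.opSpectrum, dist w z < ε → w = z) ∧
    A.eigenspace z ≠ ⊥ ∧ FiniteDimensional ℂ (A.eigenspace z)}

/-- The essential spectrum of a self-adjoint operator: what is left of the spectrum when the
discrete spectrum is removed. -/
def essSpectrum (A : E →ₗ.[ℂ] E) : Set ℂ := A.opSpectrum \ A.discreteSpectrum

/-- `t` lies strictly below the essential spectrum of `A` (always the case if that is empty). -/
def IsBelowEss (A : E →ₗ.[ℂ] E) (t : ℝ) : Prop := ∃ s > t, ∀ z ∈ A.essSpectrum, s ≤ z.re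

/-- `l 0 ≤ l 1 ≤ l 2 ≤ ⋯` is the (infinite) list of all the eigenvalues of `A` which lie below its
essential spectrum, in increasing order and each repeated according to its multiplicity. There is
at most one such sequence. With eigenvalues numbered from `1`, `l n` is the eigenvalue number
`n + 1`. -/
def IsEigenvalueSequence (A : E →ₗ.[ℂ] E) (l : ℕ → ℝ) : Prop :=
  Monotone l ∧ (∀ n, A.IsBelowEss (l n)) ∧
    ∀ t : ℝ, A.IsBelowEss t →
      {n : ℕ | l n = t}.encard = Cardinal.toENat (Module.rank ℂ (A.eigenspace (t : ℂ)))

end LinearPMap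

/-! ### Weighted graphs -/

/-- The inner product `(a, b) ↦ c * (conj a * b)` on `ℂ`, for `0 < c`. -/
@[reducible] def weightedCore (c : ℝ) (hc : 0 < c) : InnerProductSpace.Core ℂ ℂ where
  inner a b := (c : ℂ) * (conj a * b)
  conj_inner_symm a b := by simp [mul_comm]
  re_inner_nonneg a := by
    rw [Complex.conj_mul', ← Complex.ofReal_pow, ← Complex.ofReal_mul]
    exact mul_nonneg hc.le (sq_nonneg _)
  add_left a b d := by
    rw [map_add]
    ring
  smul_left a b r := by
    rw [smul_eq_mul, map_mul]
    ring
  definite a h := by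
    simpa [hc.ne'] using h

/-- A locally finite weighted graph on the vertex set `V`, all of whose connected components are
infinite; two vertices `x` and `y` are neighbours when `0 < edge x y`. -/
structure WeightedGraph (V : Type*) where
  edge : V → V → ℝ
  edge_nonneg : ∀ x y, 0 ≤ edge x y
  edge_symm : ∀ x y, edge x y = edge y x
  m : V → ℝ
  m_pos : ∀ x, 0 < m x
  locally_finite : ∀ x, {y | 0 < edge x y}.Finite
  infinite_component : ∀ x, {y | Relation.ReflTransGen (fun a b => 0 < edge a b) x y}.Infinite

namespace WeightedGraph

variable {V : Type*} (G : WeightedGraph V)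

/-- The finite set of neighbours of `x`. -/
def nbrs (x : V) : Finset V := (G.locally_finite x).toFinset

theorem mem_nbrs {x y : V} : y ∈ G.nbrs x ↔ 0 < G.edge x y := by simp [nbrs]

theorem edge_eq_zero {x y : V} (h : y ∉ G.nbrs x) : G.edge x y = 0 :=
  le_antisymm (not_lt.1 fun h' => h (G.mem_nbrs.2 h')) (G.edge_nonneg x y)

/-- The weighted degree `deg x = (∑ y, edge x y) / m x`. -/
def deg (x : V) : ℝ := (∑ y ∈ G.nbrs x, G.edge x y) / G.m x

/-- The one-dimensional Hilbert space `ℂ` with the inner product `(a, b) ↦ m x * conj a * b`. -/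
def Fiber (_G : WeightedGraph V) (_x : V) : Type := ℂ

instance (x : V) : NormedAddCommGroup (G.Fiber x) :=
  @InnerProductSpace.Core.toNormedAddCommGroup ℂ ℂ _ _ _ (weightedCore (G.m x) (G.m_pos x))

instance (x : V) : InnerProductSpace ℂ (G.Fiber x) :=
  @InnerProductSpace.ofCore ℂ ℂ _ _ _ (weightedCore (G.m x) (G.m_pos x)).1

instance (x : V) : FiniteDimensional ℂ (G.Fiber x) := inferInstanceAs (FiniteDimensional ℂ ℂ)
instance (x : V) : CompleteSpace (G.Fiber x) := FiniteDimensional.complete ℂ _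

/-- The Hilbert space `ℓ²(V, m)` of the functions `f : V → ℂ` with `∑ x, m x * ‖f x‖ ^ 2 < ∞`, with
the inner product `⟪f, g⟫ = ∑ x, m x * conj (f x) * g x`. -/
abbrev Ell2 : Type _ := lp G.Fiber 2

/-- An element of `ℓ²(V, m)` as a function `V → ℂ`. -/
def val (f : G.Ell2) (x : V) : ℂ := f x

/-- Membership of a function `V → ℂ` in `ℓ²(V, m)`. -/
def MemEll2 (f : V → ℂ) : Prop := Memℓp (E := G.Fiber) f 2

/-- The element of `ℓ²(V, m)` given by a function. -/
def toEll2 (f : V → ℂ) (hf : G.MemEll2 f) : G.Ell2 := ⟨f, hf⟩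

@[simp] theorem val_toEll2 (f : V → ℂ) (hf : G.MemEll2 f) : G.val (G.toEll2 f hf) = f := rfl

theorem val_injective : Function.Injective G.val := fun _ _ h => Subtype.ext h

@[simp] theorem val_add (f g : G.Ell2) (x : V) : G.val (f + g) x = G.val f x + G.val g x := rfl
@[simp] theorem val_smul (c : ℂ) (f : G.Ell2) (x : V) : G.val (c • f) x = c * G.val f x := rfl
@[simp] theorem val_zero (x : V) : G.val 0 x = 0 := rfl

/-- An element of a fibre as a complex number. -/
def fiberVal {x : V} (a : G.Fiber x) : ℂ := a

theorem inner_fiber (x : V) (a b : G.Fiber x) :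
    inner ℂ a b = (G.m x : ℂ) * (conj (G.fiberVal a) * G.fiberVal b) := rfl

theorem norm_fiber_sq (x : V) (a : G.Fiber x) : ‖a‖ ^ 2 = G.m x * ‖G.fiberVal a‖ ^ 2 := by
  rw [← inner_self_eq_norm_sq (𝕜 := ℂ), inner_fiber, Complex.conj_mul', ← Complex.ofReal_pow,
    ← Complex.ofReal_mul]
  rfl

theorem memEll2_iff (f : V → ℂ) : G.MemEll2 f ↔ Summable fun x => G.m x * ‖f x‖ ^ 2 := by
  have h := memℓp_gen_iff (E := G.Fiber) (p := 2) (f := f) (by norm_num)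
  unfold MemEll2
  rw [h]
  refine summable_congr fun x => ?_
  have e : G.m x * ‖f x‖ ^ 2 = _ := (G.norm_fiber_sq x (f x)).symm
  rw [e]
  norm_num

theorem norm_sq_eq (f : G.Ell2) : ‖f‖ ^ 2 = ∑' x, G.m x * ‖G.val f x‖ ^ 2 := by
  have h := lp.norm_rpow_eq_tsum (p := 2) (by norm_num) f
  have e : ∀ x, ‖f x‖ ^ (2 : ℝ) = G.m x * ‖G.val f x‖ ^ 2 := fun x => by
    rw [Real.rpow_two]
    exact G.norm_fiber_sq x (f x)
  simpa [e] using h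

theorem inner_eq (f g : G.Ell2) :
    inner ℂ f g = ∑' x, (G.m x : ℂ) * (conj (G.val f x) * G.val g x) :=
  lp.inner_eq_tsum (𝕜 := ℂ) f g

theorem memEll2_of_finite {f : V → ℂ} (hf : (Function.support f).Finite) : G.MemEll2 f := by
  rw [memEll2_iff]
  refine summable_of_hasFiniteSupport (hf.subset fun x hx => ?_)
  contrapose! hx
  simp [Function.notMem_support.1 hx]

theorem memEll2_add {f g : V → ℂ} (hf : G.MemEll2 f) (hg : G.MemEll2 g) :
    G.MemEll2 fun x => f x + g x := Memℓp.add hf hg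

theorem memEll2_const_mul {f : V → ℂ} (c : ℂ) (hf : G.MemEll2 f) :
    G.MemEll2 fun x => c * f x := Memℓp.const_smul (E := G.Fiber) hf c

/-- The space `C_c(V)` of the finitely supported functions, in `ℓ²(V, m)`. -/
def finSupp : Submodule ℂ G.Ell2 where
  carrier := {f | (Function.support (G.val f)).Finite}
  zero_mem' := by
    have : G.val 0 = 0 := rfl
    simp [this]
  add_mem' {f g} hf hg := (Set.Finite.union hf hg).subset (Function.support_add _ _)
  smul_mem' c f hf := Set.Finite.subset hf fun x hx => by
    contrapose! hx
    simp [Function.notMem_support.1 hx]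

/-- The algebraic Laplacian `(1 / m x) * ∑ y, edge x y * (f x - f y)`. -/
def lap (f : V → ℂ) (x : V) : ℂ :=
  (1 / (G.m x : ℂ)) * ∑ y ∈ G.nbrs x, (G.edge x y : ℂ) * (f x - f y)

theorem lap_support {f : V → ℂ} (hf : (Function.support f).Finite) :
    (Function.support (G.lap f)).Finite := by
  classical
  refine (hf.union (hf.biUnion fun x _ => (G.nbrs x).finite_toSet)).subset fun x hx => ?_
  by_contra hx'
  rw [Set.mem_union, not_or] at hx'
  refine hx ?_
  have h0 : f x = 0 := Function.notMem_support.1 hx'.1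
  have h1 : ∀ y ∈ G.nbrs x, f y = 0 := by
    intro y hy
    by_contra hne
    refine hx'.2 (Set.mem_biUnion (Function.mem_support.2 hne) ?_)
    rw [Finset.mem_coe, mem_nbrs, G.edge_symm]
    exact G.mem_nbrs.1 hy
  unfold lap
  rw [Finset.sum_eq_zero fun y hy => by rw [h0, h1 y hy]; simp, mul_zero]

/-- The Laplacian on `C_c(V)`, as a densely defined operator of `ℓ²(V, m)`. -/
def minLaplacian : G.Ell2 →ₗ.[ℂ] G.Ell2 where
  domain := G.finSupp
  toFun :=
    { toFun f := G.toEll2 (G.lap (G.val f)) (G.memEll2_of_finite (G.lap_support f.2))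
      map_add' f g := by
        refine G.val_injective (funext fun x => ?_)
        simp only [val_toEll2, val_add, Submodule.coe_add, lap]
        rw [← mul_add, ← Finset.sum_add_distrib]
        congr 1
        exact Finset.sum_congr rfl fun y _ => by ring
      map_smul' c f := by
        refine G.val_injective (funext fun x => ?_)
        simp only [val_toEll2, val_smul, Submodule.coe_smul, lap, RingHom.id_apply]
        rw [mul_left_comm]
        congr 1
        rw [Finset.mul_sum]
        exact Finset.sum_congr rfl fun y _ => by ring }

theorem val_minLaplacian (f : G.minLaplacian.domain) :
    G.val (G.minLaplacian f) = G.lap (G.val f) := rfl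

/-- Green's formula: `⟪f, Δ f⟫ = (1 / 2) * ∑ x, ∑ y, edge x y * ‖f x - f y‖ ^ 2`, the sum being over
any finite set that contains the support of `f` and its neighbours. -/
theorem quadForm_minLaplacian (f : G.minLaplacian.domain) (T : Finset V)
    (hT : ∀ x, G.val f x ≠ 0 → x ∈ T ∧ G.nbrs x ⊆ T) :
    G.minLaplacian.quadForm f =
      (1 / 2) * ∑ x ∈ T, ∑ y ∈ T, G.edge x y * ‖G.val f x - G.val f y‖ ^ 2 := by
  set u := G.val f with hu
  have key : inner ℂ (f : G.Ell2) (G.minLaplacian f) =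
      ∑ x ∈ T, ∑ y ∈ T, (G.edge x y : ℂ) * (conj (u x) * (u x - u y)) := by
    rw [inner_eq, tsum_eq_sum (s := T)]
    · refine Finset.sum_congr rfl fun x _ => ?_
      rw [val_minLaplacian, ← hu]
      by_cases hx : u x = 0
      · simp [hx]
      have hm : (G.m x : ℂ) ≠ 0 := by exact_mod_cast (G.m_pos x).ne'
      unfold lap
      rw [Finset.sum_subset (hT x hx).2 fun y _ hy => by rw [G.edge_eq_zero hy]; simp]
      field_simp
      rw [Finset.mul_sum]
      exact Finset.sum_congr rfl fun y _ => by ring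
    · intro x hx
      have : u x = 0 := by
        by_contra h
        exact hx (hT x h).1
      simp [← hu, this]
  have swap : ∑ x ∈ T, ∑ y ∈ T, (G.edge x y : ℂ) * (conj (u x) * (u x - u y)) =
      ∑ x ∈ T, ∑ y ∈ T, (G.edge x y : ℂ) * (conj (u y) * (u y - u x)) := by
    rw [Finset.sum_comm]
    exact Finset.sum_congr rfl fun x _ => Finset.sum_congr rfl fun y _ => by rw [G.edge_symm]
  have two : (2 : ℂ) * inner ℂ (f : G.Ell2) (G.minLaplacian f) =
      ((∑ x ∈ T, ∑ y ∈ T, G.edge x y * ‖u x - u y‖ ^ 2 : ℝ) : ℂ) := by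
    rw [two_mul]
    nth_rewrite 1 [key]
    rw [key, swap, ← swap]
    nth_rewrite 2 [swap]
    rw [← Finset.sum_add_distrib]
    push_cast
    refine Finset.sum_congr rfl fun x _ => ?_
    rw [← Finset.sum_add_distrib]
    refine Finset.sum_congr rfl fun y _ => ?_
    rw [← Complex.conj_mul', map_sub]
    ring
  have hre := congrArg Complex.re two
  rw [Complex.ofReal_re] at hre
  simp only [Complex.mul_re, Complex.re_ofNat, Complex.im_ofNat, zero_mul, sub_zero] at hre
  rw [LinearPMap.quadForm, ← hre]
  ring

theorem minLaplacian_isNonneg : G.minLaplacian.IsNonneg := by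
  classical
  intro f
  have hf : (Function.support (G.val f)).Finite := f.2
  rw [G.quadForm_minLaplacian f (hf.toFinset ∪ hf.toFinset.biUnion G.nbrs)]
  · exact mul_nonneg (by norm_num) (Finset.sum_nonneg fun x _ => Finset.sum_nonneg fun y _ =>
      mul_nonneg (G.edge_nonneg x y) (sq_nonneg _))
  · intro x hx
    have hx' : x ∈ hf.toFinset := by simpa using hx
    exact ⟨Finset.mem_union_left _ hx',
      (Finset.subset_biUnion_of_mem G.nbrs hx').trans Finset.subset_union_right⟩

/-- The Laplacian `Δ_m` of the weighted graph: the Friedrichs extension of the Laplacian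
on `C_c(V)`. -/
def laplacian : G.Ell2 →ₗ.[ℂ] G.Ell2 := G.minLaplacian.friedrichs G.minLaplacian_isNonneg

/-- The operator of multiplication by `q`, on its maximal domain `{f | q * f ∈ ℓ²(V, m)}`. -/
def mulOp (q : V → ℝ) : G.Ell2 →ₗ.[ℂ] G.Ell2 where
  domain :=
    { carrier := {f | G.MemEll2 fun x => (q x : ℂ) * G.val f x}
      zero_mem' := G.memEll2_of_finite (by simp [Function.support])
      add_mem' := fun {f g} hf hg => by
        have h := G.memEll2_add hf hg
        simpa only [Set.mem_ofPred_eq, val_add, mul_add] using h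
      smul_mem' := fun c f hf => by
        have h := G.memEll2_const_mul c hf
        simpa only [Set.mem_ofPred_eq, val_smul, mul_left_comm] using h }
  toFun :=
    { toFun f := G.toEll2 (fun x => (q x : ℂ) * G.val f x) f.2
      map_add' f g := by
        refine G.val_injective (funext fun x => ?_)
        simp only [val_toEll2, val_add, Submodule.coe_add, mul_add]
      map_smul' c f := by
        refine G.val_injective (funext fun x => ?_)
        simp only [val_toEll2, val_smul, Submodule.coe_smul, RingHom.id_apply, mul_left_comm] }

/-- A 1-dimensional decomposition, given by the function `x ↦ |x|`: the finite sets
`S_n = {x | |x| = n}` partition `V`, and neighbours lie in the same or in adjacent sets. -/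
structure OneDimDecomposition where
  level : V → ℕ
  finite_sphere : ∀ n, {x | level x = n}.Finite
  level_le : ∀ x y, 0 < G.edge x y → level y ≤ level x + 1

namespace OneDimDecomposition

variable {G} (S : G.OneDimDecomposition)

/-- `deg₊ x = (1 / m x) * ∑_{|y| = |x| + 1} edge x y`. -/
def degPlus (x : V) : ℝ :=
  (∑ y ∈ G.nbrs x with S.level y = S.level x + 1, G.edge x y) / G.m x

/-- `deg₀ x = (1 / m x) * ∑_{|y| = |x|} edge x y`. -/
def degZero (x : V) : ℝ :=
  (∑ y ∈ G.nbrs x with S.level y = S.level x, G.edge x y) / G.m x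

/-- `deg₋ x = (1 / m x) * ∑_{|y| = |x| - 1} edge x y` (zero if `|x| = 0`). -/
def degMinus (x : V) : ℝ :=
  (∑ y ∈ G.nbrs x with S.level y + 1 = S.level x, G.edge x y) / G.m x

/-- The filter of `|x| → ∞`. -/
def atInfinity : Filter V := Filter.comap S.level atTop

end OneDimDecomposition

end WeightedGraph

end

/-! Put `W = (deg + 1) ^ (-1/2)`. Since `Δ` is `deg` minus the adjacency part, `Δ + 1 = W⁻¹ T W⁻¹`,
where `T` is the identity minus the normalized adjacency operator and is bounded (`val_normLap`).
Everything rests on showing that `T` is close to the identity: for every `ε > 0` there is `C` with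
`|⟪g, T g⟫ - ‖g‖ ^ 2| ≤ ε ‖g‖ ^ 2 + C ‖W g‖ ^ 2` (`normLap_close`).

This comes from a weighted inequality `2ab ≤ s a² + s⁻¹ b²` on each edge. Charging the edges between
consecutive spheres mostly to their outer end bounds the adjacency form by that of `deg₀ + θ deg₊ +
θ⁻¹ deg₋`. As `deg₋` and `deg₀` are `o(deg₊)`, this is at most `ε (deg + 1) + C`
(`exists_deg_bound`).

Together with `Δ ≥ 0` the estimate makes `T` coercive (`isCoercive`). Hence the form domain is the
range of `W`, which is the domain of `deg ^ (1/2)`, and the Friedrichs extension is exactly `W⁻¹ T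
W⁻¹ - 1` (`laplacian_graph`). Since `deg ≥ deg₊ → ∞`, `W` is compact, and so is `(Δ + 1)⁻¹ = W T⁻¹
W`; thus `Δ` is diagonal in a Hilbert basis. Comparing forms on trial spaces in the manner of
min-max (`le_eigenvalue`, `eigenvalue_le`) gives `|λ_n(Δ) - λ_n(deg)| ≤ ε λ_n(deg) + O(1)`. -/

noncomputable section

universe u

/-! ### Increasing enumerations. -/

/-- A function on an infinite type with finite sublevel sets can be listed in increasing order. -/
theorem exists_equiv_monotone_comp {ι : Type*} [Infinite ι] (v : ι → ℝ)
    (hv : ∀ t, {i | v i ≤ t}.Finite) : ∃ e : ℕ ≃ ι, Monotone (v ∘ e) := by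
  classical
  have hmin : ∀ s : Finset ι, ∃ i, i ∉ s ∧ ∀ j, j ∉ s → v i ≤ v j := by
    intro s
    obtain ⟨a, ha⟩ := Infinite.exists_notMem_finset s
    -- Points with value above `v a` cannot compete, so the minimum may be sought in a finite
    -- sublevel set.
    obtain ⟨i, ⟨hi, hia⟩, him⟩ := Set.exists_min_image {i | i ∉ s ∧ v i ≤ v a} v
      ((hv (v a)).subset fun i hi => hi.2) ⟨a, ha, le_rfl⟩
    refine ⟨i, hi, fun j hj => ?_⟩
    rcases le_total (v j) (v a) with h | h
    · exact him j ⟨hj, h⟩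
    · exact hia.trans h
  choose pick hpick hpick_le using hmin
  -- `s n` consists of the first `n` indices of a greedy choice.
  let s : ℕ → Finset ι := fun n => Nat.rec ∅ (fun _ t => insert (pick t) t) n
  have hs : ∀ n, s (n + 1) = insert (pick (s n)) (s n) := fun n => rfl
  have hsm : Monotone s := monotone_nat_of_le_succ fun n => by
    rw [hs]
    exact Finset.subset_insert _ _
  have hmem : ∀ {m n}, m < n → pick (s m) ∈ s n := fun {m n} h =>
    hsm (Nat.succ_le_of_lt h) (by rw [hs]; exact Finset.mem_insert_self _ _)
  have hinj : Function.Injective fun n => pick (s n) := by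
    intro m n h
    change pick (s m) = pick (s n) at h
    rcases lt_trichotomy m n with h' | h' | h'
    · exact absurd (hmem h') (h ▸ hpick (s n))
    · exact h'
    · exact absurd (hmem h') (h ▸ hpick (s m))
  refine ⟨Equiv.ofBijective _ ⟨hinj, fun i => ?_⟩, monotone_nat_of_le_succ fun n => ?_⟩
  -- An index never chosen would have a value above all the chosen ones, and its finite sublevel set
  -- would contain infinitely many indices.
  · by_contra! hi
    have hnot : ∀ n, i ∉ s n := by
      intro n
      induction n with
      | zero => exact Finset.notMem_empty i
      | succ n ih =>
        rw [hs, Finset.mem_insert, not_or]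
        exact ⟨(hi n).symm, ih⟩
    exact (Set.infinite_range_of_injective hinj).mono
      (Set.range_subset_iff.2 fun n => hpick_le (s n) i (hnot n)) (hv (v i))
  · exact hpick_le (s n) _ fun h => hpick (s (n + 1)) (by rw [hs]; exact Finset.mem_insert_of_mem h)

/-! ### Hilbert bases and bounded diagonal operators. -/

namespace HilbertBasis

variable {ι E : Type*} [NormedAddCommGroup E] [InnerProductSpace ℂ E] (b : HilbertBasis ι ℂ E)

theorem hasSum_norm_sq (f : E) : HasSum (fun i => ‖inner ℂ (b i) f‖ ^ 2) (‖f‖ ^ 2) := by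
  have h := b.hasSum_inner_mul_inner f f
  have e : ∀ i, inner ℂ f (b i) * inner ℂ (b i) f = ((‖inner ℂ (b i) f‖ ^ 2 : ℝ) : ℂ) := by
    intro i
    rw [← inner_conj_symm f (b i), Complex.conj_mul', Complex.ofReal_pow]
  simp only [e, inner_self_eq_norm_sq_to_K] at h
  rw [← Complex.hasSum_ofReal, Complex.ofReal_pow]
  exact h

theorem ext_inner {f g : E} (h : ∀ i, inner ℂ (b i) f = inner ℂ (b i) g) : f = g := by
  refine b.repr.injective (lp.ext (funext fun i => ?_))
  rw [b.repr_apply_apply, b.repr_apply_apply, h]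

theorem norm_le_of_inner_le {f g : E} {C : ℝ} (hC : 0 ≤ C)
    (h : ∀ i, ‖inner ℂ (b i) f‖ ≤ C * ‖inner ℂ (b i) g‖) : ‖f‖ ≤ C * ‖g‖ := by
  refine le_of_sq_le_sq ?_ (by positivity)
  rw [mul_pow]
  refine hasSum_le (fun i => ?_) (b.hasSum_norm_sq f) ((b.hasSum_norm_sq g).mul_left (C ^ 2))
  rw [← mul_pow]
  exact pow_le_pow_left₀ (norm_nonneg _) (h i) 2

/-- Bounded coefficients define a bounded diagonal operator. -/
theorem exists_diagonal (c : ι → ℂ) {C : ℝ} (hc : ∀ i, ‖c i‖ ≤ C) :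
    ∃ D : E →L[ℂ] E, ∀ f i, inner ℂ (b i) (D f) = c i * inner ℂ (b i) f := by
  -- `C` may be negative when `ι` is empty.
  have hC : ∀ i, ‖c i‖ ≤ |C| := fun i => (hc i).trans (le_abs_self C)
  have hmem : ∀ f : E, Memℓp (fun i => c i * b.repr f i) 2 := by
    intro f
    have h := (lp.memℓp (b.repr f)).summable (by norm_num)
    refine memℓp_gen ((h.mul_left (|C| ^ 2)).of_nonneg_of_le (fun i => by positivity) fun i => ?_)
    simp only [ENNReal.toReal_ofNat, Real.rpow_two]
    rw [norm_mul, mul_pow]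
    gcongr
    exact hC i
  let L : E →ₗ[ℂ] E :=
    { toFun f := b.repr.symm ⟨_, hmem f⟩
      map_add' f g := by
        rw [← map_add]
        congr 1
        ext i
        simp only [map_add, lp.coeFn_add, Pi.add_apply]
        exact mul_add _ _ _
      map_smul' a f := by
        rw [RingHom.id_apply, ← map_smul]
        congr 1
        ext i
        simp only [map_smul, lp.coeFn_smul, Pi.smul_apply, smul_eq_mul]
        exact mul_left_comm _ _ _ }
  have hL : ∀ f i, inner ℂ (b i) (L f) = c i * inner ℂ (b i) f := by
    intro f i
    rw [← b.repr_apply_apply, ← b.repr_apply_apply]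
    change (b.repr (b.repr.symm ⟨_, hmem f⟩)) i = _
    rw [LinearIsometryEquiv.apply_symm_apply]
  refine ⟨L.mkContinuous |C| fun f => b.norm_le_of_inner_le (abs_nonneg C) fun i => ?_, hL⟩
  rw [hL, norm_mul]
  gcongr
  exact hC i

theorem isSymmetric_of_diagonal {D : E →L[ℂ] E} {c : ι → ℝ}
    (hD : ∀ f i, inner ℂ (b i) (D f) = c i * inner ℂ (b i) f) : D.IsSymmetric := by
  intro f g
  refine (b.hasSum_inner_mul_inner _ _).unique ?_
  convert! b.hasSum_inner_mul_inner f (D g) using 2 with i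
  rw [hD, ← inner_conj_symm (ContinuousLinearMap.toLinearMap D f), ContinuousLinearMap.coe_coe,
    hD, map_mul, Complex.conj_ofReal, inner_conj_symm]
  ring

/-- Truncations to finitely many indices have finite rank, and they converge in norm because the
entries tend to zero. -/
theorem isCompactOperator_of_diagonal [CompleteSpace E] {D : E →L[ℂ] E} {c : ι → ℂ}
    (hD : ∀ f i, inner ℂ (b i) (D f) = c i * inner ℂ (b i) f) (hc : Tendsto c cofinite (𝓝 0)) :
    IsCompactOperator D := by
  classical
  let F : Finset ι → E →L[ℂ] E := fun s =>
    ∑ i ∈ s, (ContinuousLinearMap.toSpanSingleton ℂ (b i)).comp (c i • innerSL ℂ (b i))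
  have hF : ∀ s, IsCompactOperator (F s) := by
    intro s
    refine Submodule.sum_mem (compactOperator (RingHom.id ℂ) E E) fun i _ => ?_
    exact (isCompactOperator_of_locallyCompactSpace_rng
      (ContinuousLinearMap.toSpanSingleton ℂ (b i))).comp_clm (c i • innerSL ℂ (b i))
  have hFi : ∀ s f i, inner ℂ (b i) (F s f) = if i ∈ s then c i * inner ℂ (b i) f else 0 := by
    intro s f i
    simp only [F, sum_apply, ContinuousLinearMap.comp_apply, inner_sum,
      ContinuousLinearMap.toSpanSingleton_apply, inner_smul_right,
      orthonormal_iff_ite.1 b.orthonormal, smul_apply, smul_eq_mul,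
      innerSL_apply_apply]
    simp
  refine isCompactOperator_of_tendsto (l := atTop) (F := F) ?_ (Eventually.of_forall hF)
  rw [Metric.tendsto_atTop]
  intro ε hε
  have hfin : {i | ¬ ‖c i‖ < ε / 2}.Finite :=
    (tendsto_zero_iff_norm_tendsto_zero.1 hc).eventually (gt_mem_nhds (half_pos hε))
  refine ⟨hfin.toFinset, fun s hs => ?_⟩
  rw [dist_eq_norm]
  refine lt_of_le_of_lt (ContinuousLinearMap.opNorm_le_bound _ (half_pos hε).le fun f => ?_)
    (half_lt_self hε)
  refine b.norm_le_of_inner_le (half_pos hε).le fun i => ?_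
  rw [sub_apply, inner_sub_right, hFi, hD]
  split_ifs with hi
  · simp only [sub_self, norm_zero]
    positivity
  · rw [zero_sub, norm_neg, norm_mul]
    gcongr
    by_contra h
    exact hi (hs (hfin.mem_toFinset.2 fun h' => h h'.le))

/-- The same Hilbert basis, with another index type. -/
def reindex [CompleteSpace E] {κ : Type*} (e : κ ≃ ι) : HilbertBasis κ ℂ E :=
  HilbertBasis.mk (v := b ∘ e) (b.orthonormal.comp e e.injective)
    (by rw [e.surjective.range_comp, b.dense_span])

theorem reindex_apply [CompleteSpace E] {κ : Type*} (e : κ ≃ ι) (i : κ) : b.reindex e i = b (e i) := by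
  rw [reindex, HilbertBasis.coe_mk, Function.comp_apply]

end HilbertBasis

/-- A compact self-adjoint operator has a Hilbert basis of eigenvectors. -/
theorem ContinuousLinearMap.exists_eigenvector_hilbertBasis {E : Type u} [NormedAddCommGroup E]
    [InnerProductSpace ℂ E] [CompleteSpace E] {T : E →L[ℂ] E} (hT : IsCompactOperator T)
    (hT' : T.IsSymmetric) :
    ∃ (ι : Type u) (b : HilbertBasis ι ℂ E) (μ : ι → ℝ), ∀ i, T (b i) = (μ i : ℂ) • b i := by
  -- All complex `μ` are allowed: if `μ` is not an eigenvalue, the space is zero and contributes no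
  -- basis vector.
  let V : ℂ → Submodule ℂ E := fun μ => Module.End.eigenspace (T : Module.End ℂ E) μ
  have hcl : ∀ μ, IsClosed (V μ : Set E) := by
    intro μ
    have : (V μ : Set E) = {f | T f = μ • f} := by
      ext f
      exact Module.End.mem_eigenspace_iff
    rw [this]
    exact isClosed_eq T.continuous (continuous_const_smul μ)
  have : ∀ μ, CompleteSpace (V μ) := fun μ => (hcl μ).completeSpace_coe
  choose w b _ using fun μ => exists_hilbertBasis ℂ (V μ)
  have hon : Orthonormal ℂ fun a : Σ μ, w μ => (V a.1).subtypeₗᵢ (b a.1 a.2) :=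
    hT'.orthogonalFamily_eigenspaces.orthonormal_sigma_orthonormal fun μ => (b μ).orthonormal
  -- By the spectral theorem the eigenspaces together have trivial orthogonal complement, so it is
  -- enough that each lies in the closed span of its own basis.
  have hsp : (Submodule.span ℂ (Set.range fun a : Σ μ, w μ => (V a.1).subtypeₗᵢ (b a.1 a.2)))ᗮ
      = ⊥ := by
    rw [eq_bot_iff, ← orthogonalComplement_iSup_eigenspaces_eq_bot hT hT',
      ← Submodule.orthogonal_closure (Submodule.span ℂ _)]
    refine Submodule.orthogonal_le (iSup_le fun μ f hf => ?_)
    refine mem_closure_of_tendsto ((V μ).subtypeL.hasSum ((b μ).hasSum_repr ⟨f, hf⟩))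
      (Eventually.of_forall fun s => Submodule.sum_mem _ fun i _ => ?_)
    rw [map_smul]
    exact Submodule.smul_mem _ _ (Submodule.subset_span ⟨⟨μ, i⟩, rfl⟩)
  let B := HilbertBasis.mkOfOrthogonalEqBot hon hsp
  have hB : ∀ a, T (B a) = a.1 • B a := by
    intro a
    rw [HilbertBasis.coe_mkOfOrthogonalEqBot]
    exact Module.End.mem_eigenspace_iff.1 (b a.1 a.2).2
  refine ⟨_, B, fun a => a.1.re, fun a => ?_⟩
  have h0 : B a ≠ 0 := B.orthonormal.ne_zero a
  rw [hB, Complex.conj_eq_iff_re.1 (hT'.conj_eigenvalue_eq_self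
    (Module.End.hasEigenvalue_of_hasEigenvector (Module.End.hasEigenvector_iff.2
      ⟨Module.End.mem_eigenspace_iff.2 (hB a), h0⟩)))]

/-! ### Unbounded diagonal operators and their spectra. -/

namespace LinearPMap

variable {ι E : Type*} [NormedAddCommGroup E] [InnerProductSpace ℂ E]

/-- `A` is the operator, on its maximal domain, which is diagonal in the Hilbert basis `b`, with
diagonal entries `v`. -/
def IsDiagonal (A : E →ₗ.[ℂ] E) (b : HilbertBasis ι ℂ E) (v : ι → ℝ) : Prop :=
  ∀ f u, (∃ h : f ∈ A.domain, A ⟨f, h⟩ = u) ↔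
    ∀ i, inner ℂ (b i) u = (v i : ℂ) * inner ℂ (b i) f

namespace IsDiagonal

/-- Values above `z.re + 1` are at distance at least `1` from `z`, and the others different from `z`
form a finite, hence closed, set. The gap both bounds the resolvent and isolates the points of the
spectrum. -/
theorem exists_gap {v : ι → ℝ} (hv : ∀ t, {i | v i ≤ t}.Finite) (z : ℂ) :
    ∃ ε > 0, ∀ i, (v i : ℂ) ≠ z → ε ≤ ‖(v i : ℂ) - z‖ := by
  have hfin : ((fun i => (v i : ℂ)) '' {i | v i ≤ z.re + 1 ∧ (v i : ℂ) ≠ z}).Finite :=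
    ((hv (z.re + 1)).subset fun i hi => hi.1).image _
  obtain ⟨ε, hε, h⟩ := Metric.isOpen_iff.1 hfin.isClosed.isOpen_compl z
    (by rintro ⟨i, hi, h⟩; exact hi.2 h)
  refine ⟨min ε 1, lt_min hε one_pos, fun i hi => ?_⟩
  by_contra! hlt
  have h1 : v i - z.re ≤ ‖(v i : ℂ) - z‖ := by
    simpa using Complex.re_le_norm ((v i : ℂ) - z)
  refine h (mem_ball_iff_norm.2 (hlt.trans_le (min_le_left _ _))) ⟨i, ⟨?_, hi⟩, rfl⟩
  linarith [min_le_right ε 1]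

variable {A : E →ₗ.[ℂ] E} {b : HilbertBasis ι ℂ E} {v : ι → ℝ}

theorem mem_eigenspace_iff (hA : A.IsDiagonal b v) {z : ℂ} {f : E} :
    f ∈ A.eigenspace z ↔ ∀ i, inner ℂ (b i) f ≠ 0 → (v i : ℂ) = z := by
  refine (hA f (z • f)).trans (forall_congr' fun i => ?_)
  rw [inner_smul_right, mul_eq_mul_right_iff, ← or_iff_not_imp_right, eq_comm]

theorem apply_mem_eigenspace (hA : A.IsDiagonal b v) (i : ι) : b i ∈ A.eigenspace (v i) := by
  classical
  refine hA.mem_eigenspace_iff.2 fun j hj => ?_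
  rw [orthonormal_iff_ite.1 b.orthonormal] at hj
  rw [(ite_ne_right_iff.1 hj).1]

/-- Only finitely many entries equal `z`, so the expansion of an eigenvector is a finite sum and the
span needs no closure. -/
theorem eigenspace_eq_span (hA : A.IsDiagonal b v) (hv : ∀ t, {i | v i ≤ t}.Finite) (z : ℂ) :
    A.eigenspace z = Submodule.span ℂ (b '' {i | (v i : ℂ) = z}) := by
  classical
  refine le_antisymm (fun f hf => ?_) (Submodule.span_le.2 ?_)
  · have hfin : {i | (v i : ℂ) = z}.Finite :=
      (hv z.re).subset fun i (hi : (v i : ℂ) = z) => by simp [← hi]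
    have h := b.hasSum_repr f
    rw [h.unique (hasSum_sum_of_ne_finset_zero (s := hfin.toFinset) fun i hi => ?_)]
    · exact Submodule.sum_mem _ fun i hi => Submodule.smul_mem _ _
        (Submodule.subset_span ⟨i, hfin.mem_toFinset.1 hi, rfl⟩)
    · rw [b.repr_apply_apply]
      by_contra h0
      exact hi (hfin.mem_toFinset.2 (hA.mem_eigenspace_iff.1 hf i fun h' => h0 (by simp [h'])))
  · rintro _ ⟨i, rfl, rfl⟩
    exact hA.apply_mem_eigenspace i

theorem rank_eigenspace (hA : A.IsDiagonal b v) (hv : ∀ t, {i | v i ≤ t}.Finite) (z : ℂ) :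
    Cardinal.toENat (Module.rank ℂ (A.eigenspace z)) = {i | (v i : ℂ) = z}.encard := by
  rw [hA.eigenspace_eq_span hv,
    rank_span_set ((b.orthonormal.linearIndependent.linearIndepOn _).id_image)]
  exact b.orthonormal.linearIndependent.injective.encard_image _

/-- Away from the entries the resolvent is diagonal with entries `(v i - z)⁻¹`, bounded by
`exists_gap`; at an entry, `A - z` kills a basis vector. -/
theorem mem_opSpectrum_iff (hA : A.IsDiagonal b v) (hv : ∀ t, {i | v i ≤ t}.Finite) {z : ℂ} :
    z ∈ A.opSpectrum ↔ ∃ i, (v i : ℂ) = z := by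
  constructor
  · contrapose!
    intro hz
    obtain ⟨ε, hε, h⟩ := exists_gap hv z
    obtain ⟨R, hR⟩ := b.exists_diagonal (fun i => ((v i : ℂ) - z)⁻¹) (C := ε⁻¹) fun i => by
      rw [norm_inv]
      exact inv_anti₀ hε (h i (hz i))
    have hz' : ∀ i, (v i : ℂ) - z ≠ 0 := fun i => sub_ne_zero.2 (hz i)
    refine Set.notMem_compl_iff.2 ⟨R, fun y => ?_, fun x => b.ext_inner fun i => ?_⟩
    · obtain ⟨h1, h2⟩ := (hA (R y) (y + z • R y)).2 fun i => by
        rw [inner_add_right, inner_smul_right, hR]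
        field_simp [hz' i]
        ring
      exact ⟨h1, by rw [h2, add_sub_cancel_right]⟩
    · rw [hR, inner_sub_right, inner_smul_right, (hA x (A x)).1 ⟨x.2, rfl⟩ i, ← sub_mul,
        inv_mul_cancel_left₀ (hz' i)]
  · rintro ⟨i, rfl⟩ ⟨R, -, hR⟩
    obtain ⟨h1, h2⟩ := hA.apply_mem_eigenspace i
    have h := hR ⟨b i, h1⟩
    rw [h2, sub_self, _root_.map_zero] at h
    exact b.orthonormal.ne_zero i h.symm

theorem essSpectrum_eq_empty (hA : A.IsDiagonal b v) (hv : ∀ t, {i | v i ≤ t}.Finite) :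
    A.essSpectrum = ∅ := by
  refine Set.sdiff_eq_empty.2 fun z hz => ⟨hz, ?_, ?_, ?_⟩
  · obtain ⟨ε, hε, h⟩ := exists_gap hv z
    refine ⟨ε, hε, fun w hw hwz => ?_⟩
    obtain ⟨i, rfl⟩ := (hA.mem_opSpectrum_iff hv).1 hw
    by_contra hne
    rw [dist_eq_norm] at hwz
    exact (h i hne).not_gt hwz
  · obtain ⟨i, rfl⟩ := (hA.mem_opSpectrum_iff hv).1 hz
    exact (Submodule.ne_bot_iff _).2 ⟨b i, hA.apply_mem_eigenspace i, b.orthonormal.ne_zero i⟩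
  · rw [hA.eigenspace_eq_span hv]
    refine FiniteDimensional.span_of_finite ℂ (Set.Finite.image _ ?_)
    exact (hv z.re).subset fun i (hi : (v i : ℂ) = z) => by simp [← hi]

theorem isEigenvalueSequence (hA : A.IsDiagonal b v) (hv : ∀ t, {i | v i ≤ t}.Finite)
    (e : ℕ ≃ ι) (he : Monotone (v ∘ e)) : A.IsEigenvalueSequence (v ∘ e) := by
  refine ⟨he, fun n => ⟨_, lt_add_one _, by simp [hA.essSpectrum_eq_empty hv]⟩, fun t _ => ?_⟩
  rw [hA.rank_eigenspace hv, ← e.injective.encard_image]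
  congr 1
  ext i
  simp only [Set.mem_image, Set.mem_ofPred_eq, Function.comp_apply, Complex.ofReal_inj]
  exact ⟨by rintro ⟨n, h, rfl⟩; exact h, fun h => ⟨e.symm i, by simpa using h, by simp⟩⟩

end IsDiagonal

end LinearPMap

/-! ### Trial vectors by dimension counting. -/

/-- A dimension count: finitely many linear conditions have a nonzero solution in the span of a
larger finite set of basis vectors. -/
theorem HilbertBasis.exists_ne_zero_inner_eq_zero {ι E : Type*} [NormedAddCommGroup E]
    [InnerProductSpace ℂ E] (b : HilbertBasis ι ℂ E) (s : Finset ι) {n : ℕ} (hn : n < s.card)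
    (w : ℕ → E) :
    ∃ f ∈ Submodule.span ℂ (b '' s), f ≠ 0 ∧ (∀ i ∉ s, inner ℂ (b i) f = 0) ∧
      ∀ j < n, inner ℂ (w j) f = 0 := by
  classical
  let S : (s → ℂ) →ₗ[ℂ] E := Fintype.linearCombination ℂ fun i : s => b i
  let L : (s → ℂ) →ₗ[ℂ] (Fin n → ℂ) :=
    LinearMap.pi fun j => (innerSL ℂ (w j)).toLinearMap ∘ₗ S
  obtain ⟨a, ha, ha0⟩ := (Submodule.ne_bot_iff _).1
    (L.ker_ne_bot_of_finrank_lt (by simpa using hn))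
  have hS : S a = ∑ i : s, a i • b i := Fintype.linearCombination_apply ..
  have hlin : LinearIndependent ℂ fun i : s => b i :=
    b.orthonormal.linearIndependent.comp _ Subtype.val_injective
  refine ⟨S a, ?_, fun h => ha0 ?_, fun i hi => ?_, fun j hj => ?_⟩
  · rw [hS]
    exact Submodule.sum_mem _ fun i _ => Submodule.smul_mem _ _
      (Submodule.subset_span ⟨i, i.2, rfl⟩)
  · exact funext (Fintype.linearIndependent_iff.1 hlin a (hS ▸ h))
  · rw [hS, inner_sum]
    refine Finset.sum_eq_zero fun j _ => ?_
    rw [inner_smul_right, orthonormal_iff_ite.1 b.orthonormal, if_neg, mul_zero]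
    rintro rfl
    exact hi j.2
  · exact congrFun (LinearMap.mem_ker.1 ha) ⟨j, hj⟩

/-- A finite basis would make the space finite-dimensional. This is what allows the eigenvalues of a
perturbation to be indexed by `ℕ`. -/
theorem HilbertBasis.infinite_index {ι κ E : Type*} [Infinite κ] [NormedAddCommGroup E]
    [InnerProductSpace ℂ E] (d : HilbertBasis κ ℂ E) (b : HilbertBasis ι ℂ E) : Infinite ι := by
  by_contra hfin
  rw [not_infinite_iff_finite] at hfin
  have := Fintype.ofFinite ι
  have : Module.Finite ℂ E := b.toOrthonormalBasis.toBasis.finiteDimensional_of_finite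
  exact not_finite_iff_infinite.2 ‹Infinite κ› d.orthonormal.linearIndependent.finite

/-! ### Eigenvalue asymptotics for perturbations of diagonal operators. -/

namespace LinearPMap

variable {E : Type u} [NormedAddCommGroup E] [InnerProductSpace ℂ E]

/-- `A + 1 = W⁻¹ T W⁻¹`, where `W⁻² - 1` is diagonal with entries `k` increasing to infinity, and
`T` is a symmetric coercive operator which is close to the identity, up to an error which is
bounded in terms of `W`. -/
structure IsDiagonalPerturbation (A : E →ₗ.[ℂ] E) (d : HilbertBasis ℕ ℂ E) (k : ℕ → ℝ)
    (W T : E →L[ℂ] E) : Prop where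
  k_nonneg : ∀ n, 0 ≤ k n
  k_mono : Monotone k
  k_tendsto : Tendsto k atTop atTop
  inner_W : ∀ f n, inner ℂ (d n) (W f) = (((√(k n + 1))⁻¹ : ℝ) : ℂ) * inner ℂ (d n) f
  T_symm : T.IsSymmetric
  T_coercive : ∃ δ > 0, ∀ g, δ * ‖g‖ ^ 2 ≤ (inner ℂ g (T g)).re
  T_close : ∀ ε > 0, ∃ C, ∀ g, |(inner ℂ g (T g)).re - ‖g‖ ^ 2| ≤ ε * ‖g‖ ^ 2 + C * ‖W g‖ ^ 2
  -- Equality of graphs fixes the domain of `A` as well as its values, and writing `f = W g` avoids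
  -- the unbounded `W⁻¹`.
  graph : ∀ f u, (∃ h : f ∈ A.domain, A ⟨f, h⟩ = u) ↔ ∃ g, W g = f ∧ T g = W (u + f)
  mem_domain : ∀ n, d n ∈ A.domain

namespace IsDiagonalPerturbation

variable {A : E →ₗ.[ℂ] E} {d : HilbertBasis ℕ ℂ E} {k : ℕ → ℝ} {W T : E →L[ℂ] E}
  (h : A.IsDiagonalPerturbation d k W T)

include h

theorem sqrt_pos (n : ℕ) : 0 < √(k n + 1) := Real.sqrt_pos.2 (by linarith [h.k_nonneg n])

theorem W_symm : W.IsSymmetric := d.isSymmetric_of_diagonal h.inner_W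

theorem W_injective : Function.Injective W := by
  rw [injective_iff_map_eq_zero]
  intro g hg
  refine d.ext_inner fun n => ?_
  have h1 := h.inner_W g n
  rw [hg, inner_zero_right, eq_comm, mul_eq_zero, Complex.ofReal_eq_zero, inv_eq_zero] at h1
  rw [h1.resolve_left (h.sqrt_pos n).ne', inner_zero_right]

theorem W_compact [CompleteSpace E] : IsCompactOperator W := by
  refine d.isCompactOperator_of_diagonal h.inner_W ?_
  rw [Nat.cofinite_eq_atTop, ← Complex.ofReal_zero]
  refine (Complex.continuous_ofReal.tendsto 0).comp (tendsto_inv_atTop_zero.comp ?_)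
  exact Real.tendsto_sqrt_atTop.comp (tendsto_atTop_add_const_right _ 1 h.k_tendsto)

/-- `A` has compact resolvent, so that it can be diagonalized. -/
theorem exists_isDiagonal [CompleteSpace E] :
    ∃ (ι : Type u) (b : HilbertBasis ι ℂ E) (v : ι → ℝ), A.IsDiagonal b v := by
  obtain ⟨δ, hδ, hT⟩ := h.T_coercive
  -- Coercivity makes `T` invertible, as in the Lax–Milgram theorem.
  have hunit : IsUnit T := by
    refine ContinuousLinearMap.isUnit_of_forall_le_norm_inner_map T (c := ⟨δ, hδ.le⟩) hδ fun g => ?_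
    rw [mul_comm, ← inner_conj_symm, RCLike.norm_conj]
    exact (hT g).trans (Complex.re_le_norm _)
  obtain ⟨U, rfl⟩ := hunit
  set S : E →L[ℂ] E := ↑U⁻¹ with hS
  have hST : ∀ g, S ((U : E →L[ℂ] E) g) = g := fun g => by
    rw [← mul_apply_eq_comp, hS, Units.inv_mul, one_apply_eq_self]
  have hTS : ∀ g, (U : E →L[ℂ] E) (S g) = g := fun g => by
    rw [← mul_apply_eq_comp, hS, Units.mul_inv, one_apply_eq_self]
  have hSs : ∀ f g, inner ℂ (S f) g = inner ℂ f (S g) := fun f g => by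
    conv_lhs => rw [← hTS g]
    rw [← ContinuousLinearMap.coe_coe (U : E →L[ℂ] E), ← h.T_symm, ContinuousLinearMap.coe_coe, hTS]
  have hWs : ∀ f g, inner ℂ (W f) g = inner ℂ f (W g) := h.W_symm
  -- `R = W T⁻¹ W` is the inverse of `A + 1`.
  let R : E →L[ℂ] E := W.comp (S.comp W)
  have hRc : IsCompactOperator R := h.W_compact.comp_clm (S.comp W)
  have hRs : R.IsSymmetric := fun f g => by
    change inner ℂ (W (S (W f))) g = inner ℂ f (W (S (W g)))
    rw [hWs, hSs, hWs]
  obtain ⟨ι, b, μ, hb⟩ := ContinuousLinearMap.exists_eigenvector_hilbertBasis hRc hRs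
  have hμ : ∀ i, (μ i : ℂ) ≠ 0 := by
    intro i h0
    have h1 : W (S (W (b i))) = W 0 := by
      rw [_root_.map_zero]
      exact (hb i).trans (by rw [h0, zero_smul])
    have h2 := congrArg (U : E →L[ℂ] E) (h.W_injective h1)
    rw [hTS, _root_.map_zero, ← _root_.map_zero W] at h2
    exact b.orthonormal.ne_zero i (h.W_injective h2)
  have hR : ∀ f i, inner ℂ (b i) (R f) = μ i * inner ℂ (b i) f := fun f i => by
    rw [← ContinuousLinearMap.coe_coe R, ← hRs, ContinuousLinearMap.coe_coe, hb, inner_smul_left,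
      Complex.conj_ofReal]
  -- `A = R⁻¹ - 1`, read off in the eigenbasis of `R`.
  refine ⟨ι, b, fun i => (μ i)⁻¹ - 1, fun f u => ?_⟩
  have hiff : (∃ g, W g = f ∧ (U : E →L[ℂ] E) g = W (u + f)) ↔ R (u + f) = f := by
    constructor
    · rintro ⟨g, rfl, hg⟩
      change W (S (W (u + W g))) = W g
      rw [← hg, hST]
    · exact fun hf => ⟨S (W (u + f)), hf, hTS _⟩
  rw [h.graph, hiff]
  have hcoord : ∀ i, inner ℂ (b i) (R (u + f)) = inner ℂ (b i) f ↔
      inner ℂ (b i) u = (((μ i)⁻¹ - 1 : ℝ) : ℂ) * inner ℂ (b i) f := by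
    intro i
    rw [hR, inner_add_right, Complex.ofReal_sub, Complex.ofReal_inv, Complex.ofReal_one, sub_mul,
      one_mul, eq_sub_iff_add_eq, eq_inv_mul_iff_mul_eq₀ (hμ i)]
  exact ⟨fun hf i => (hcoord i).1 (by rw [hf]), fun hf => b.ext_inner fun i => (hcoord i).2 (hf i)⟩

variable {ι : Type*} {b : HilbertBasis ι ℂ E} {v : ι → ℝ}

/-- On the domain of `A`, the form of `T` is the form of `A + 1`. -/
theorem exists_hasSum_form (hA : A.IsDiagonal b v) {f : E} (hf : f ∈ A.domain) :
    ∃ g, W g = f ∧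
      HasSum (fun i => (v i + 1) * ‖inner ℂ (b i) f‖ ^ 2) (inner ℂ g (T g)).re := by
  obtain ⟨g, hg, hg'⟩ := (h.graph f (A ⟨f, hf⟩)).1 ⟨hf, rfl⟩
  refine ⟨g, hg, ?_⟩
  have h1 : inner ℂ g (T g) = inner ℂ f (A ⟨f, hf⟩ + f) := by
    rw [hg', ← ContinuousLinearMap.coe_coe W, ← h.W_symm, ContinuousLinearMap.coe_coe, hg]
  rw [h1]
  convert! Complex.hasSum_re (b.hasSum_inner_mul_inner f (A ⟨f, hf⟩ + f)) using 2 with i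
  rw [inner_add_right, (hA f _).1 ⟨hf, rfl⟩ i, ← inner_conj_symm f (b i)]
  rw [show conj (inner ℂ (b i) f) * ((v i : ℂ) * inner ℂ (b i) f + inner ℂ (b i) f) =
    ((v i + 1 : ℝ) : ℂ) * (conj (inner ℂ (b i) f) * inner ℂ (b i) f) by push_cast; ring,
    Complex.conj_mul', ← Complex.ofReal_pow, ← Complex.ofReal_mul, Complex.ofReal_re]

/-- Summed over `n`, this says that `‖g‖ ^ 2` is the form of the unperturbed diagonal operator plus
one at `W g`. -/
theorem inner_W_sq (g : E) (n : ℕ) :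
    ‖inner ℂ (d n) g‖ ^ 2 = (k n + 1) * ‖inner ℂ (d n) (W g)‖ ^ 2 := by
  have h0 : 0 < k n + 1 := by linarith [h.k_nonneg n]
  rw [h.inner_W, norm_mul, Complex.norm_real, norm_inv, Real.norm_of_nonneg (Real.sqrt_nonneg _),
    mul_pow, inv_pow, Real.sq_sqrt h0.le, mul_inv_cancel_left₀ h0.ne']

/-- The `n`-th diagonal entry `k n` is at most any of `n + 1` eigenvalues of `A`, up to an error. -/
theorem le_eigenvalue (hA : A.IsDiagonal b v) {ε C : ℝ} (hε : ε ≤ 1)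
    (hC : ∀ g, |(inner ℂ g (T g)).re - ‖g‖ ^ 2| ≤ ε * ‖g‖ ^ 2 + C * ‖W g‖ ^ 2)
    {s : Finset ι} {n : ℕ} (hn : n < s.card) {t : ℝ} (ht : ∀ i ∈ s, v i ≤ t) :
    (1 - ε) * (k n + 1) ≤ t + 1 + C := by
  -- Spanned by more than `n` eigenvectors, `f` has form of `A + 1` at most `(t + 1) ‖f‖ ^ 2`;
  -- orthogonal to `d 0, …, d (n - 1)`, it has diagonal form at least `(k n + 1) ‖f‖ ^ 2`.
  obtain ⟨f, hfs, hf0, hfi, hfd⟩ := b.exists_ne_zero_inner_eq_zero s hn d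
  have hf : f ∈ A.domain := by
    refine Submodule.span_le.2 ?_ hfs
    rintro _ ⟨i, -, rfl⟩
    exact (hA.apply_mem_eigenspace i).1
  obtain ⟨g, rfl, hg⟩ := h.exists_hasSum_form hA hf
  have h1 : (inner ℂ g (T g)).re ≤ (t + 1) * ‖W g‖ ^ 2 := by
    refine hasSum_le (fun i => ?_) hg ((b.hasSum_norm_sq (W g)).mul_left (t + 1))
    by_cases hi : i ∈ s
    · gcongr
      exact ht i hi
    · simp [hfi i hi]
  have h2 : (k n + 1) * ‖W g‖ ^ 2 ≤ ‖g‖ ^ 2 := by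
    refine hasSum_le (fun i => ?_) ((d.hasSum_norm_sq (W g)).mul_left (k n + 1))
      (d.hasSum_norm_sq g)
    rw [h.inner_W_sq g]
    rcases lt_or_ge i n with hi | hi
    · simp [hfd i hi]
    · gcongr
      exact h.k_mono hi
  have h3 : 0 < ‖W g‖ ^ 2 := by positivity
  have h4 := (abs_le.1 (hC g)).1
  have h5 := mul_le_mul_of_nonneg_left h2 (sub_nonneg.2 hε)
  refine le_of_mul_le_mul_right ?_ h3
  linarith

/-- The `n`-th eigenvalue of `A` is at most the `n`-th diagonal entry `k n`, up to an error. -/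
theorem eigenvalue_le (hA : A.IsDiagonal b v) {ε C : ℝ} (hε : 0 ≤ ε)
    (hC : ∀ g, |(inner ℂ g (T g)).re - ‖g‖ ^ 2| ≤ ε * ‖g‖ ^ 2 + C * ‖W g‖ ^ 2)
    (e : ℕ ≃ ι) (he : Monotone (v ∘ e)) (n : ℕ) :
    v (e n) + 1 ≤ (1 + ε) * (k n + 1) + C := by
  -- The roles are exchanged: `f` is spanned by `d 0, …, d n` and orthogonal to the first `n`
  -- eigenvectors of `A`.
  obtain ⟨f, hfs, hf0, hfd, hfi⟩ := d.exists_ne_zero_inner_eq_zero (Finset.range (n + 1))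
    (n := n) (by simp) (b ∘ e)
  have hf : f ∈ A.domain := by
    refine Submodule.span_le.2 ?_ hfs
    rintro _ ⟨i, -, rfl⟩
    exact h.mem_domain i
  obtain ⟨g, rfl, hg⟩ := h.exists_hasSum_form hA hf
  have h1 : (v (e n) + 1) * ‖W g‖ ^ 2 ≤ (inner ℂ g (T g)).re := by
    refine hasSum_le (fun i => ?_) ((b.hasSum_norm_sq (W g)).mul_left (v (e n) + 1)) hg
    obtain ⟨m, rfl⟩ := e.surjective i
    rcases lt_or_ge m n with hm | hm
    · have := hfi m hm
      simp only [Function.comp_apply] at this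
      simp [this]
    · gcongr
      exact he hm
  have h2 : ‖g‖ ^ 2 ≤ (k n + 1) * ‖W g‖ ^ 2 := by
    refine hasSum_le (fun i => ?_) (d.hasSum_norm_sq g)
      ((d.hasSum_norm_sq (W g)).mul_left (k n + 1))
    rw [h.inner_W_sq g]
    by_cases hi : i ∈ Finset.range (n + 1)
    · gcongr
      exact h.k_mono (Nat.lt_succ_iff.1 (Finset.mem_range.1 hi))
    · simp [hfd i hi]
  have h3 : 0 < ‖W g‖ ^ 2 := by positivity
  have h4 := (abs_le.1 (hC g)).2
  have h5 := mul_le_mul_of_nonneg_left h2 (add_nonneg zero_le_one hε)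
  refine le_of_mul_le_mul_right ?_ h3
  linarith

/-- With infinitely many eigenvalues below `t`, `le_eigenvalue` would apply for every `n` and bound
the unbounded sequence `k`. -/
theorem finite_sublevel (hA : A.IsDiagonal b v) (t : ℝ) : {i | v i ≤ t}.Finite := by
  by_contra hinf
  obtain ⟨C, hC⟩ := h.T_close (1 / 2) (by norm_num)
  obtain ⟨n, hn⟩ := (h.k_tendsto.eventually_gt_atTop (2 * (t + 1 + C))).exists
  obtain ⟨s, hs, hs'⟩ := Set.Infinite.exists_subset_card_eq hinf (n + 1)
  have := h.le_eigenvalue hA (by norm_num) hC (s := s) (n := n) (by omega) fun i hi => hs hi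
  linarith

/-- `A` has purely discrete spectrum, and its eigenvalues are asymptotic to the entries of the
diagonal operator of which it is a perturbation. -/
theorem exists_isEigenvalueSequence [CompleteSpace E] :
    A.essSpectrum = ∅ ∧ ∃ l, A.IsEigenvalueSequence l ∧
      Tendsto (fun n => l n / k n) atTop (𝓝 1) := by
  obtain ⟨ι, b, v, hA⟩ := h.exists_isDiagonal
  have hfin := h.finite_sublevel hA
  have := d.infinite_index b
  obtain ⟨e, he⟩ := exists_equiv_monotone_comp v hfin
  refine ⟨hA.essSpectrum_eq_empty hfin, v ∘ e, hA.isEigenvalueSequence hfin e he, ?_⟩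
  refine (isEquivalent_iff_tendsto_one ?_).1 (isLittleO_iff.2 fun {ε} hε => ?_)
  · filter_upwards [h.k_tendsto.eventually_gt_atTop 0] with n hn using hn.ne'
  -- Half of `ε` pays for `η * k n`, the other half for the constant `C + η` once `k n` is large;
  -- `le_eigenvalue` needs `η ≤ 1`.
  set η := min (ε / 2) 1 with hη
  have hη0 : 0 < η := lt_min (half_pos hε) one_pos
  obtain ⟨C, hC⟩ := h.T_close η hη0
  filter_upwards [h.k_tendsto.eventually_ge_atTop ((C + η) / (ε / 2))] with n hn
  have h1 := h.le_eigenvalue hA (min_le_right _ _) hC (s := (Finset.range (n + 1)).map e.toEmbedding)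
    (n := n) (t := v (e n)) (by simp) fun i hi => by
      obtain ⟨m, hm, rfl⟩ := Finset.mem_map.1 hi
      exact he (Nat.lt_succ_iff.1 (Finset.mem_range.1 hm))
  have h2 := h.eigenvalue_le hA hη0.le hC e he n
  have h3 : η * k n ≤ ε / 2 * k n :=
    mul_le_mul_of_nonneg_right (min_le_left _ _) (h.k_nonneg n)
  rw [div_le_iff₀' (half_pos hε)] at hn
  rw [Real.norm_eq_abs, Real.norm_of_nonneg (h.k_nonneg n), abs_le]
  simp only [Pi.sub_apply, Function.comp_apply]
  constructor <;> linarith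

end IsDiagonalPerturbation

end LinearPMap

namespace WeightedGraph

variable {V : Type*} (G : WeightedGraph V)

/-! ### Multiplication operators -/

/-- The unit vector of `ℓ²(V, m)` supported at `x`. -/
def delta (x : V) : G.Ell2 :=
  letI := Classical.decEq V
  lp.single 2 x (((√(G.m x))⁻¹ : ℝ) : ℂ)

theorem val_delta_of_ne {x y : V} (h : y ≠ x) : G.val (G.delta x) y = 0 :=
  letI := Classical.decEq V
  lp.single_apply_ne 2 x _ h

theorem inner_delta (x : V) (f : G.Ell2) :
    inner ℂ (G.delta x) f = ((√(G.m x) : ℝ) : ℂ) * G.val f x := by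
  classical
  have h : inner ℂ (G.delta x) f = (G.m x : ℂ) * (conj (((√(G.m x))⁻¹ : ℝ) : ℂ) * G.val f x) := by
    unfold delta
    convert! lp.inner_single_left (𝕜 := ℂ) (G := G.Fiber) x (((√(G.m x))⁻¹ : ℝ) : ℂ) f
  have hm : (((√(G.m x)) : ℝ) : ℂ) ≠ 0 := by exact_mod_cast (Real.sqrt_pos.2 (G.m_pos x)).ne'
  rw [h, Complex.conj_ofReal, ← mul_assoc, Complex.ofReal_inv]
  congr 1
  rw [← div_eq_mul_inv, div_eq_iff hm, ← Complex.ofReal_mul, Real.mul_self_sqrt (G.m_pos x).le]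

theorem sqrt_m_ne_zero (x : V) : ((√(G.m x) : ℝ) : ℂ) ≠ 0 := by
  exact_mod_cast (Real.sqrt_pos.2 (G.m_pos x)).ne'

theorem orthonormal_delta : Orthonormal ℂ G.delta := by
  classical
  rw [orthonormal_iff_ite]
  intro x y
  rw [inner_delta]
  split_ifs with h
  · subst h
    have : G.val (G.delta x) x = (((√(G.m x))⁻¹ : ℝ) : ℂ) := by
      unfold delta val
      convert! lp.single_apply_self (E := G.Fiber) 2 x (((√(G.m x))⁻¹ : ℝ) : ℂ)
    rw [this, Complex.ofReal_inv, mul_inv_cancel₀ (G.sqrt_m_ne_zero x)]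
  · rw [G.val_delta_of_ne h, mul_zero]

/-- The Hilbert basis of the normalized indicator functions of the vertices. -/
def deltaBasis : HilbertBasis V ℂ G.Ell2 :=
  HilbertBasis.mkOfOrthogonalEqBot G.orthonormal_delta (by
    refine (Submodule.eq_bot_iff _).2 fun f hf => G.val_injective (funext fun x => ?_)
    have h := hf _ (Submodule.subset_span ⟨x, rfl⟩)
    rw [inner_delta] at h
    exact (mul_eq_zero.1 h).resolve_left (G.sqrt_m_ne_zero x))

theorem deltaBasis_apply (x : V) : G.deltaBasis x = G.delta x := by
  rw [deltaBasis, HilbertBasis.coe_mkOfOrthogonalEqBot]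

theorem inner_deltaBasis (x : V) (f : G.Ell2) :
    inner ℂ (G.deltaBasis x) f = ((√(G.m x) : ℝ) : ℂ) * G.val f x := by
  rw [deltaBasis_apply, inner_delta]

theorem delta_mem_finSupp (x : V) : G.delta x ∈ G.finSupp := by
  refine (Set.finite_singleton x).subset fun y hy => ?_
  by_contra h
  exact hy (G.val_delta_of_ne h)

theorem dense_finSupp : Dense (G.finSupp : Set G.Ell2) := by
  have h : Submodule.span ℂ (Set.range G.deltaBasis) ≤ G.finSupp := by
    rw [Submodule.span_le]
    rintro _ ⟨x, rfl⟩
    rw [deltaBasis_apply]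
    exact G.delta_mem_finSupp x
  have hd : Dense (Submodule.span ℂ (Set.range G.deltaBasis) : Set G.Ell2) := by
    rw [Submodule.dense_iff_topologicalClosure_eq_top, G.deltaBasis.dense_span]
  exact hd.mono h

theorem mulOp_isDiagonal (q : V → ℝ) : (G.mulOp q).IsDiagonal G.deltaBasis q := by
  intro f u
  have h : (∀ x, inner ℂ (G.deltaBasis x) u = (q x : ℂ) * inner ℂ (G.deltaBasis x) f) ↔
      G.val u = fun x => (q x : ℂ) * G.val f x := by
    rw [funext_iff]
    refine forall_congr' fun x => ?_
    rw [inner_deltaBasis, inner_deltaBasis, mul_left_comm]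
    exact mul_right_inj' (G.sqrt_m_ne_zero x)
  rw [h]
  constructor
  · rintro ⟨h1, rfl⟩
    rfl
  · intro hu
    have hmem : G.MemEll2 fun x => (q x : ℂ) * G.val f x := hu ▸ u.2
    exact ⟨hmem, G.val_injective hu.symm⟩

/-! ### The normalized adjacency operator -/

theorem deg_nonneg (x : V) : 0 ≤ G.deg x :=
  div_nonneg (Finset.sum_nonneg fun y _ => G.edge_nonneg x y) (G.m_pos x).le

theorem sum_nbrs_edge (x : V) : ∑ y ∈ G.nbrs x, G.edge x y = G.m x * G.deg x := by
  rw [deg, mul_div_cancel₀ _ (G.m_pos x).ne']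

theorem sum_edge_mul_le (x : V) (s : Finset V) {c : V → ℝ} (hc : ∀ y, 0 ≤ c y) :
    ∑ y ∈ s, G.edge x y * c y ≤ ∑ y ∈ G.nbrs x, G.edge x y * c y := by
  classical
  have h : ∑ y ∈ s ∩ G.nbrs x, G.edge x y * c y = ∑ y ∈ s, G.edge x y * c y := by
    refine Finset.sum_subset Finset.inter_subset_left fun y hy hy' => ?_
    rw [G.edge_eq_zero fun h => hy' (Finset.mem_inter.2 ⟨hy, h⟩), zero_mul]
  rw [← h]
  exact Finset.sum_le_sum_of_subset_of_nonneg Finset.inter_subset_right fun y _ _ =>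
    mul_nonneg (G.edge_nonneg x y) (hc y)

/-- The function `(deg + 1) ^ (-1 / 2)`. -/
def weight (x : V) : ℝ := (√(G.deg x + 1))⁻¹

theorem deg_add_one_pos (x : V) : 0 < G.deg x + 1 := by linarith [G.deg_nonneg x]

theorem weight_pos (x : V) : 0 < G.weight x := inv_pos.2 (Real.sqrt_pos.2 (G.deg_add_one_pos x))

theorem weight_sq (x : V) : G.weight x ^ 2 = (G.deg x + 1)⁻¹ := by
  rw [weight, inv_pow, Real.sq_sqrt (G.deg_add_one_pos x).le]

theorem deg_mul_weight_sq_le (x : V) : G.deg x * G.weight x ^ 2 ≤ 1 := by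
  rw [weight_sq, ← div_eq_mul_inv, div_le_one (G.deg_add_one_pos x)]
  linarith

theorem weight_le_one (x : V) : G.weight x ≤ 1 := by
  refine inv_le_one_of_one_le₀ (Real.one_le_sqrt.2 ?_)
  linarith [G.deg_nonneg x]

theorem exists_weightOp : ∃ W : G.Ell2 →L[ℂ] G.Ell2, ∀ f x,
    inner ℂ (G.deltaBasis x) (W f) = (G.weight x : ℂ) * inner ℂ (G.deltaBasis x) f :=
  G.deltaBasis.exists_diagonal (C := 1) (fun x => (G.weight x : ℂ)) fun x => by
    rw [Complex.norm_real, Real.norm_of_nonneg (G.weight_pos x).le]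
    exact G.weight_le_one x

/-- Multiplication by `(deg + 1) ^ (-1 / 2)`. -/
def weightOp : G.Ell2 →L[ℂ] G.Ell2 := G.exists_weightOp.choose

theorem inner_weightOp (f : G.Ell2) (x : V) : inner ℂ (G.deltaBasis x) (G.weightOp f) =
    (G.weight x : ℂ) * inner ℂ (G.deltaBasis x) f := G.exists_weightOp.choose_spec f x

theorem val_weightOp (f : G.Ell2) (x : V) : G.val (G.weightOp f) x = G.weight x * G.val f x := by
  have h := G.inner_weightOp f x
  rw [inner_deltaBasis, inner_deltaBasis, mul_left_comm] at h
  exact mul_left_cancel₀ (G.sqrt_m_ne_zero x) h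

theorem weightOp_symm (f g : G.Ell2) :
    inner ℂ (G.weightOp f) g = inner ℂ f (G.weightOp g) :=
  G.deltaBasis.isSymmetric_of_diagonal G.inner_weightOp f g

theorem weightOp_mem_finSupp {f : G.Ell2} (hf : f ∈ G.finSupp) : G.weightOp f ∈ G.finSupp := by
  refine Set.Finite.subset hf fun x hx h => hx ?_
  rw [val_weightOp, h, mul_zero]

/-- `W` maps `C_c(V)` onto itself, so test functions may be written as `W γ` with `γ` finitely
supported. -/
theorem exists_weightOp_eq {f : G.Ell2} (hf : f ∈ G.finSupp) :
    ∃ g ∈ G.finSupp, G.weightOp g = f := by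
  have h : (Function.support fun x => (G.weight x : ℂ)⁻¹ * G.val f x).Finite :=
    Set.Finite.subset hf fun x hx h => hx (by simp [h])
  refine ⟨G.toEll2 _ (G.memEll2_of_finite h), h, G.val_injective (funext fun x => ?_)⟩
  have : (G.weight x : ℂ) ≠ 0 := by exact_mod_cast (G.weight_pos x).ne'
  rw [val_weightOp, val_toEll2, mul_inv_cancel_left₀ this]

/-- The normalized adjacency matrix, as an operator on functions. -/
def adj (f : V → ℂ) (x : V) : ℂ :=
  (G.weight x : ℂ) * ((G.m x : ℂ)⁻¹ * ∑ y ∈ G.nbrs x, (G.edge x y : ℂ) * (G.weight y * f y))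

/-- Cauchy–Schwarz with each edge weight split as a product of square roots; the factor `∑ edge = m
* deg` is absorbed by `weight ^ 2`. -/
theorem m_mul_norm_adj_sq_le (f : V → ℂ) (x : V) :
    G.m x * ‖G.adj f x‖ ^ 2 ≤ ∑ y ∈ G.nbrs x, G.edge x y * (G.weight y * ‖f y‖) ^ 2 := by
  set B := ∑ y ∈ G.nbrs x, G.edge x y * (G.weight y * ‖f y‖) ^ 2
  have hB : 0 ≤ B := Finset.sum_nonneg fun y _ => mul_nonneg (G.edge_nonneg x y) (sq_nonneg _)
  have h1 : ‖∑ y ∈ G.nbrs x, (G.edge x y : ℂ) * (G.weight y * f y)‖ ^ 2 ≤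
      G.m x * G.deg x * B := by
    have h2 : ‖∑ y ∈ G.nbrs x, (G.edge x y : ℂ) * (G.weight y * f y)‖ ≤
        ∑ y ∈ G.nbrs x, √(G.edge x y) * (√(G.edge x y) * (G.weight y * ‖f y‖)) := by
      refine (norm_sum_le _ _).trans_eq (Finset.sum_congr rfl fun y _ => ?_)
      rw [norm_mul, norm_mul, Complex.norm_real, Complex.norm_real,
        Real.norm_of_nonneg (G.edge_nonneg x y), Real.norm_of_nonneg (G.weight_pos y).le,
        ← mul_assoc √_, Real.mul_self_sqrt (G.edge_nonneg x y)]
    refine (pow_le_pow_left₀ (norm_nonneg _) h2 2).trans ?_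
    refine (Finset.sum_mul_sq_le_sq_mul_sq _ _ _).trans_eq ?_
    rw [← sum_nbrs_edge]
    congr 1
    · exact Finset.sum_congr rfl fun y _ => Real.sq_sqrt (G.edge_nonneg x y)
    · exact Finset.sum_congr rfl fun y _ => by rw [mul_pow, Real.sq_sqrt (G.edge_nonneg x y)]
  have hm := G.m_pos x
  rw [adj, norm_mul, norm_mul, norm_inv, Complex.norm_real, Complex.norm_real,
    Real.norm_of_nonneg hm.le, Real.norm_of_nonneg (G.weight_pos x).le, mul_pow, mul_pow]
  calc _ ≤ G.m x * (G.weight x ^ 2 * ((G.m x)⁻¹ ^ 2 * (G.m x * G.deg x * B))) := by gcongr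
    _ = (G.deg x * G.weight x ^ 2) * B := by field_simp
    _ ≤ B := mul_le_of_le_one_left hB (G.deg_mul_weight_sq_le x)

/-- Second half of the Schur test: summing over `x` first, symmetry of the edge weights gives `m y *
deg y`, again absorbed by `weight ^ 2`. So the norm is at most `1`. -/
theorem sum_norm_adj_sq_le (f : G.Ell2) (s : Finset V) :
    ∑ x ∈ s, G.m x * ‖G.adj (G.val f) x‖ ^ 2 ≤ ‖f‖ ^ 2 := by
  classical
  set t := s.biUnion G.nbrs
  calc _ ≤ ∑ x ∈ s, ∑ y ∈ t, G.edge x y * (G.weight y * ‖G.val f y‖) ^ 2 := by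
        refine Finset.sum_le_sum fun x hx => (G.m_mul_norm_adj_sq_le _ x).trans ?_
        exact Finset.sum_le_sum_of_subset_of_nonneg (Finset.subset_biUnion_of_mem G.nbrs hx)
          fun y _ _ => mul_nonneg (G.edge_nonneg x y) (sq_nonneg _)
    _ = ∑ y ∈ t, (G.weight y * ‖G.val f y‖) ^ 2 * ∑ x ∈ s, G.edge y x * 1 := by
        rw [Finset.sum_comm]
        refine Finset.sum_congr rfl fun y _ => ?_
        rw [Finset.mul_sum]
        exact Finset.sum_congr rfl fun x _ => by rw [G.edge_symm]; ring
    _ ≤ ∑ y ∈ t, (G.weight y * ‖G.val f y‖) ^ 2 * (G.m y * G.deg y) := by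
        refine Finset.sum_le_sum fun y _ => mul_le_mul_of_nonneg_left ?_ (sq_nonneg _)
        refine (G.sum_edge_mul_le y s fun _ => zero_le_one).trans_eq ?_
        simp only [mul_one, sum_nbrs_edge]
    _ ≤ ∑ y ∈ t, G.m y * ‖G.val f y‖ ^ 2 := by
        refine Finset.sum_le_sum fun y _ => ?_
        have := mul_le_mul_of_nonneg_left (G.deg_mul_weight_sq_le y)
          (mul_nonneg (G.m_pos y).le (sq_nonneg ‖G.val f y‖))
        linarith
    _ ≤ ‖f‖ ^ 2 := by
        rw [norm_sq_eq]
        exact Summable.sum_le_tsum t (fun y _ => mul_nonneg (G.m_pos y).le (sq_nonneg _))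
          ((G.memEll2_iff _).1 f.2)

theorem memEll2_adj (f : G.Ell2) : G.MemEll2 (G.adj (G.val f)) :=
  (G.memEll2_iff _).2 (summable_of_sum_le
    (fun x => mul_nonneg (G.m_pos x).le (sq_nonneg _)) (G.sum_norm_adj_sq_le f))

/-- The normalized adjacency matrix, as a bounded operator on `ℓ²(V, m)`. -/
def adjOp : G.Ell2 →L[ℂ] G.Ell2 :=
  LinearMap.mkContinuous
    { toFun f := G.toEll2 (G.adj (G.val f)) (G.memEll2_adj f)
      map_add' f g := by
        refine G.val_injective (funext fun x => ?_)
        simp only [val_toEll2, val_add, adj]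
        rw [← mul_add, ← mul_add, ← Finset.sum_add_distrib]
        simp only [mul_add]
      map_smul' c f := by
        refine G.val_injective (funext fun x => ?_)
        simp only [val_toEll2, val_smul, adj, RingHom.id_apply]
        rw [mul_left_comm c, mul_left_comm c]
        congr 2
        rw [Finset.mul_sum]
        exact Finset.sum_congr rfl fun y _ => by ring } 1 fun f => by
    rw [one_mul]
    refine le_of_sq_le_sq ?_ (norm_nonneg _)
    rw [norm_sq_eq]
    exact Real.tsum_le_of_sum_le (fun x => mul_nonneg (G.m_pos x).le (sq_nonneg _))
      (G.sum_norm_adj_sq_le f)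

theorem val_adjOp (f : G.Ell2) : G.val (G.adjOp f) = G.adj (G.val f) := rfl

/-- The operator `T` such that `Δ + 1 = (deg + 1) ^ (1 / 2) T (deg + 1) ^ (1 / 2)`. -/
def normLap : G.Ell2 →L[ℂ] G.Ell2 := ContinuousLinearMap.id ℂ G.Ell2 - G.adjOp

theorem normLap_apply (f : G.Ell2) : G.normLap f = f - G.adjOp f := rfl

/-- Pointwise `T = W (Δ + 1) W`, because `(deg + 1) * weight ^ 2 = 1`. Local finiteness makes this
valid on all of `ℓ²`. -/
theorem val_normLap (f : G.Ell2) (x : V) : G.val (G.normLap f) x =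
    G.weight x * (G.lap (G.val (G.weightOp f)) x + G.val (G.weightOp f) x) := by
  have hm : (G.m x : ℂ) ≠ 0 := by exact_mod_cast (G.m_pos x).ne'
  have hd : ∑ y ∈ G.nbrs x, (G.edge x y : ℂ) = G.m x * G.deg x := by
    exact_mod_cast G.sum_nbrs_edge x
  have hw : (G.weight x : ℂ) * (G.deg x + 1) * G.weight x = 1 := by
    have h := mul_inv_cancel₀ (G.deg_add_one_pos x).ne'
    rw [← weight_sq] at h
    rw [mul_comm, ← mul_assoc, ← sq, mul_comm]
    exact_mod_cast h
  have h1 : G.val (G.normLap f) x = G.val f x - G.adj (G.val f) x := rfl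
  rw [h1, adj, lap]
  simp only [val_weightOp, mul_sub, Finset.sum_sub_distrib]
  rw [← Finset.sum_mul, hd]
  have h2 : (1 / (G.m x : ℂ)) * ((G.m x : ℂ) * G.deg x * (G.weight x * G.val f x)) =
    G.deg x * (G.weight x * G.val f x) := by field_simp
  rw [h2]
  linear_combination -(G.val f x) * hw

end WeightedGraph

theorem LinearPMap.formDomain_mono {E : Type*} [NormedAddCommGroup E] [InnerProductSpace ℂ E]
    {A B : E →ₗ.[ℂ] E} (h : A ≤ B) : A.formDomain ⊆ B.formDomain := by
  rintro f ⟨φ, hφ, hφ'⟩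
  refine ⟨fun n => ⟨φ n, h.1 (φ n).2⟩, hφ, hφ'.congr fun p => ?_⟩
  have e : A (φ p.1 - φ p.2) =
      B (⟨φ p.1, h.1 (φ p.1).2⟩ - ⟨φ p.2, h.1 (φ p.2).2⟩) := h.2 rfl
  rw [quadForm, quadForm, e]
  rfl

/-! ### Symmetry of `T` and its form on finitely supported functions. -/

namespace WeightedGraph

variable {V : Type*} (G : WeightedGraph V)

theorem inner_adjOp (f g : G.Ell2) (s : Finset V) (hf : ∀ x ∉ s, G.val f x = 0)
    (hg : ∀ x ∉ s, G.val g x = 0) :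
    inner ℂ f (G.adjOp g) = ∑ x ∈ s, ∑ y ∈ s, (G.edge x y : ℂ) *
      (conj (G.val (G.weightOp f) x) * G.val (G.weightOp g) y) := by
  classical
  rw [inner_eq, tsum_eq_sum (s := s) fun x hx => by simp [hf x hx]]
  refine Finset.sum_congr rfl fun x _ => ?_
  have hm : (G.m x : ℂ) ≠ 0 := by exact_mod_cast (G.m_pos x).ne'
  have hsum : ∑ y ∈ G.nbrs x, (G.edge x y : ℂ) * (G.weight y * G.val g y) =
      ∑ y ∈ s, (G.edge x y : ℂ) * (G.weight y * G.val g y) := by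
    refine (Finset.sum_subset (Finset.subset_union_left (s₂ := s)) fun y _ hy => ?_).trans
      (Finset.sum_subset (Finset.subset_union_right (s₁ := G.nbrs x)) fun y _ hy => ?_).symm
    · rw [G.edge_eq_zero hy, Complex.ofReal_zero, zero_mul]
    · rw [hg y hy, mul_zero, mul_zero]
  rw [val_adjOp, adj, hsum, Finset.mul_sum, Finset.mul_sum, Finset.mul_sum, Finset.mul_sum]
  refine Finset.sum_congr rfl fun y _ => ?_
  rw [val_weightOp, val_weightOp, map_mul, Complex.conj_ofReal]
  field_simp

theorem val_eq_zero_of_notMem {f : G.Ell2} (hf : f ∈ G.finSupp) {s : Finset V}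
    (hs : Set.Finite.toFinset hf ⊆ s) : ∀ x ∉ s, G.val f x = 0 := fun x hx => by
  by_contra h
  exact hx (hs ((Set.Finite.mem_toFinset hf).2 h))

theorem adjOp_symm (f g : G.Ell2) : inner ℂ (G.adjOp f) g = inner ℂ f (G.adjOp g) := by
  classical
  refine G.dense_finSupp.induction (P := fun f => inner ℂ (G.adjOp f) g = inner ℂ f (G.adjOp g))
    (fun f hf => ?_) (isClosed_eq (by fun_prop) (by fun_prop)) f
  refine G.dense_finSupp.induction (P := fun g => inner ℂ (G.adjOp f) g = inner ℂ f (G.adjOp g))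
    (fun g hg => ?_) (isClosed_eq (by fun_prop) (by fun_prop)) g
  have hf' := G.val_eq_zero_of_notMem hf (Finset.subset_union_left (s₂ := Set.Finite.toFinset hg))
  have hg' := G.val_eq_zero_of_notMem hg (Finset.subset_union_right (s₁ := Set.Finite.toFinset hf))
  rw [← inner_conj_symm, G.inner_adjOp g f _ hg' hf', G.inner_adjOp f g _ hf' hg', map_sum]
  simp only [map_sum]
  rw [Finset.sum_comm]
  refine Finset.sum_congr rfl fun x _ => Finset.sum_congr rfl fun y _ => ?_
  rw [map_mul, map_mul, Complex.conj_conj, Complex.conj_ofReal, G.edge_symm]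
  ring

theorem normLap_symm (f g : G.Ell2) : inner ℂ (G.normLap f) g = inner ℂ f (G.normLap g) := by
  rw [normLap_apply, normLap_apply, inner_sub_left, inner_sub_right, adjOp_symm]

theorem normLap_eq {g : G.Ell2} (φ : G.minLaplacian.domain) (h : G.weightOp g = φ) :
    G.normLap g = G.weightOp (G.minLaplacian φ + φ) := by
  refine G.val_injective (funext fun x => ?_)
  rw [val_normLap, G.val_weightOp (_ + _), val_add, val_minLaplacian, h]

/-- The substitution `φ = W g` carries the form of `Δ + 1` to the bounded form of `T`. -/
theorem re_inner_normLap {g : G.Ell2} (φ : G.minLaplacian.domain) (h : G.weightOp g = φ) :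
    (inner ℂ g (G.normLap g)).re = G.minLaplacian.quadForm φ + ‖(φ : G.Ell2)‖ ^ 2 := by
  rw [G.normLap_eq φ h, ← weightOp_symm, h, inner_add_right, Complex.add_re,
    LinearPMap.quadForm, inner_self_eq_norm_sq_to_K]
  congr 1
  exact_mod_cast Complex.ofReal_re _

/-- This is `Δ ≥ 0` on `C_c(V)`, extended by density. It absorbs the error `C ‖W g‖ ^ 2` in the
proof of coercivity. -/
theorem norm_weightOp_sq_le (g : G.Ell2) :
    ‖G.weightOp g‖ ^ 2 ≤ (inner ℂ g (G.normLap g)).re := by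
  refine G.dense_finSupp.induction
    (P := fun g => ‖G.weightOp g‖ ^ 2 ≤ (inner ℂ g (G.normLap g)).re) (fun g hg => ?_)
    (isClosed_le (by fun_prop) (Complex.continuous_re.comp (by fun_prop))) g
  rw [G.re_inner_normLap ⟨_, G.weightOp_mem_finSupp hg⟩ rfl]
  exact le_add_of_nonneg_left (G.minLaplacian_isNonneg _)

/-! ### Form domains -/

/-- The form of `T` is coercive. -/
def IsCoercive : Prop := ∃ δ > 0, ∀ g, δ * ‖g‖ ^ 2 ≤ (inner ℂ g (G.normLap g)).re

variable {G}

/-- By coercivity, a sequence that is Cauchy for the form norm has Cauchy preimages under `W`. A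
general `B` serves both the Laplacian on `C_c(V)` and its Friedrichs extension. -/
theorem formDomain_subset_range (hG : G.IsCoercive) {B : G.Ell2 →ₗ.[ℂ] G.Ell2}
    (hB : ∀ φ : B.domain, ∃ g, G.weightOp g = φ ∧
      (inner ℂ g (G.normLap g)).re = B.quadForm φ + ‖(φ : G.Ell2)‖ ^ 2) :
    B.formDomain ⊆ Set.range G.weightOp := by
  rintro f ⟨φ, hφ, hφ'⟩
  obtain ⟨δ, hδ, hT⟩ := hG
  have hW : Function.Injective G.weightOp := by
    rw [injective_iff_map_eq_zero]
    refine fun g hg => G.val_injective (funext fun x => ?_)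
    have h := G.val_weightOp g x
    rw [hg, val_zero, eq_comm, mul_eq_zero, Complex.ofReal_eq_zero] at h
    exact h.resolve_left (G.weight_pos x).ne'
  choose γ hγ hγ' using hB
  have hsub : ∀ p q, γ (p - q) = γ p - γ q := fun p q =>
    hW (by rw [map_sub, hγ, hγ, hγ, Submodule.coe_sub])
  have hcauchy : CauchySeq fun n => γ (φ n) := by
    rw [cauchySeq_iff_tendsto_dist_atTop_0]
    have h1 := cauchySeq_iff_tendsto_dist_atTop_0.1 hφ.cauchySeq
    have h2 := (hφ'.add (h1.pow 2)).const_mul δ⁻¹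
    have h3 : Tendsto (fun p : ℕ × ℕ => dist (γ (φ p.1)) (γ (φ p.2)) ^ 2) atTop (𝓝 0) := by
      refine squeeze_zero (fun _ => sq_nonneg _) (fun p => ?_) (by simpa using h2)
      rw [dist_eq_norm, dist_eq_norm, ← hsub, ← Submodule.coe_sub, ← hγ', le_inv_mul_iff₀ hδ]
      exact hT _
    have h4 := (Real.continuous_sqrt.tendsto 0).comp h3
    simpa [Function.comp_def, Real.sqrt_sq dist_nonneg] using h4
  obtain ⟨g, hg⟩ := cauchySeq_tendsto_of_complete hcauchy
  refine ⟨g, tendsto_nhds_unique ((G.weightOp.continuous.tendsto g).comp hg) ?_⟩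
  simpa only [Function.comp_def, hγ] using hφ

theorem formDomain_minLaplacian_subset (hG : G.IsCoercive) :
    G.minLaplacian.formDomain ⊆ Set.range G.weightOp :=
  formDomain_subset_range hG fun φ => by
    obtain ⟨g, -, hg⟩ := G.exists_weightOp_eq φ.2
    exact ⟨g, hg, G.re_inner_normLap φ hg⟩

variable (G) in
-- Approximate `g` by finitely supported functions; since `T` is bounded, their images under `W` are
-- Cauchy for the form.
theorem range_subset_formDomain_minLaplacian :
    Set.range G.weightOp ⊆ G.minLaplacian.formDomain := by
  rintro _ ⟨g, rfl⟩
  obtain ⟨γ, hγ, hγg⟩ := mem_closure_iff_seq_limit.1 (G.dense_finSupp g)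
  refine ⟨fun n => ⟨G.weightOp (γ n), G.weightOp_mem_finSupp (hγ n)⟩,
    (G.weightOp.continuous.tendsto g).comp hγg, ?_⟩
  have h1 := ((cauchySeq_iff_tendsto_dist_atTop_0.1 hγg.cauchySeq).pow 2).const_mul ‖G.normLap‖
  refine squeeze_zero (fun p => G.minLaplacian_isNonneg _) (fun p => ?_) (by simpa using h1)
  have h2 := G.re_inner_normLap (g := γ p.1 - γ p.2)
    (⟨G.weightOp (γ p.1), G.weightOp_mem_finSupp (hγ p.1)⟩ -
      ⟨G.weightOp (γ p.2), G.weightOp_mem_finSupp (hγ p.2)⟩) (by rw [map_sub, Submodule.coe_sub])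
  rw [dist_eq_norm]
  calc _ ≤ _ := le_add_of_nonneg_right (sq_nonneg _)
    _ = _ := h2.symm
    _ ≤ _ := Complex.re_le_norm _
    _ ≤ _ := norm_inner_le_norm _ _
    _ ≤ _ := mul_le_mul_of_nonneg_left (G.normLap.le_opNorm _) (norm_nonneg _)
    _ = _ := by ring

/-- The form domain supplies `f = W g`. Tested against `W γ` with `γ` in the dense space `C_c(V)`,
the adjoint relation becomes `T g = W (u + f)`. -/
theorem laplacian_graph (hG : G.IsCoercive) (f u : G.Ell2) :
    (∃ h : f ∈ G.laplacian.domain, G.laplacian ⟨f, h⟩ = u) ↔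
      ∃ g, G.weightOp g = f ∧ G.normLap g = G.weightOp (u + f) := by
  have hd : Dense (G.minLaplacian.domain : Set G.Ell2) := G.dense_finSupp
  constructor
  · rintro ⟨⟨h1, h2⟩, hu⟩
    obtain ⟨g, rfl⟩ := formDomain_minLaplacian_subset hG h1
    refine ⟨g, rfl, G.dense_finSupp.eq_of_inner_left ℂ fun γ hγ => ?_⟩
    let φ : G.minLaplacian.domain := ⟨G.weightOp γ, G.weightOp_mem_finSupp hγ⟩
    have h3 : inner ℂ u (φ : G.Ell2) = inner ℂ (G.weightOp g) (G.minLaplacian φ) := by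
      rw [← hu]
      exact LinearPMap.adjoint_isFormalAdjoint hd ⟨_, h2⟩ φ
    rw [normLap_symm, G.normLap_eq φ rfl, ← weightOp_symm, inner_add_right, ← h3,
      ← inner_add_left, weightOp_symm]
  · rintro ⟨g, rfl, hg⟩
    have h3 : ∀ φ : G.minLaplacian.domain,
        inner ℂ u (φ : G.Ell2) = inner ℂ (G.weightOp g) (G.minLaplacian φ) := by
      intro φ
      obtain ⟨γ, -, hγ⟩ := G.exists_weightOp_eq φ.2
      have h4 := G.normLap_symm g γ
      rw [hg, weightOp_symm, hγ, G.normLap_eq φ hγ, ← weightOp_symm, inner_add_left,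
        inner_add_right] at h4
      exact add_right_cancel h4
    have h2 := G.minLaplacian.mem_adjoint_domain_of_exists (G.weightOp g) ⟨u, h3⟩
    exact ⟨⟨G.range_subset_formDomain_minLaplacian ⟨g, rfl⟩, h2⟩,
      LinearPMap.adjoint_apply_eq hd ⟨_, h2⟩ h3⟩

theorem minLaplacian_le_laplacian (hG : G.IsCoercive) : G.minLaplacian ≤ G.laplacian := by
  have h : ∀ φ : G.minLaplacian.domain, ∃ h : (φ : G.Ell2) ∈ G.laplacian.domain,
      G.laplacian ⟨φ, h⟩ = G.minLaplacian φ := fun φ => by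
    obtain ⟨g, -, hg⟩ := G.exists_weightOp_eq φ.2
    exact (laplacian_graph hG _ _).2 ⟨g, hg, G.normLap_eq φ hg⟩
  refine ⟨fun f hf => (h ⟨f, hf⟩).1, fun {x y} hxy => ?_⟩
  obtain ⟨h1, h2⟩ := h x
  rw [← h2]
  congr 1
  exact Subtype.ext hxy

/-- Passing to the Friedrichs extension adds nothing: its form is still that of `T`, so the same
completion argument applies to its larger domain. -/
theorem formDomain_laplacian (hG : G.IsCoercive) :
    G.laplacian.formDomain = Set.range G.weightOp := by
  refine Set.Subset.antisymm (formDomain_subset_range hG fun φ => ?_)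
    (G.range_subset_formDomain_minLaplacian.trans
      (LinearPMap.formDomain_mono (minLaplacian_le_laplacian hG)))
  obtain ⟨g, hg, hg'⟩ := (laplacian_graph hG φ (G.laplacian φ)).1 ⟨φ.2, rfl⟩
  refine ⟨g, hg, ?_⟩
  rw [hg', ← weightOp_symm, hg, inner_add_right, Complex.add_re,
    LinearPMap.quadForm, inner_self_eq_norm_sq_to_K]
  congr 1
  exact_mod_cast Complex.ofReal_re _

variable (G) in
-- For `f` already in `ℓ²`, `(deg + 1) ^ (1/2) f` is in `ℓ²` exactly when `deg ^ (1/2) f` is.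
theorem range_weightOp :
    Set.range G.weightOp = (G.mulOp fun x => √(G.deg x)).domain := by
  ext f
  change f ∈ Set.range G.weightOp ↔ G.MemEll2 fun x => (√(G.deg x) : ℂ) * G.val f x
  have hn : ∀ x (z : ℂ), G.m x * ‖((√(G.deg x) : ℝ) : ℂ) * z‖ ^ 2 =
      G.m x * (G.deg x * ‖z‖ ^ 2) := fun x z => by
    rw [norm_mul, Complex.norm_real, Real.norm_of_nonneg (Real.sqrt_nonneg _), mul_pow,
      Real.sq_sqrt (G.deg_nonneg x)]
  constructor
  · rintro ⟨g, rfl⟩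
    rw [memEll2_iff]
    refine ((G.memEll2_iff _).1 g.2).of_nonneg_of_le
      (fun x => mul_nonneg (G.m_pos x).le (sq_nonneg _)) fun x => ?_
    rw [hn, val_weightOp, norm_mul, Complex.norm_real, Real.norm_of_nonneg (G.weight_pos x).le,
      mul_pow, ← mul_assoc (G.deg x)]
    exact mul_le_mul_of_nonneg_left
      (mul_le_of_le_one_left (sq_nonneg _) (G.deg_mul_weight_sq_le x)) (G.m_pos x).le
  · intro hf
    have hmem : G.MemEll2 fun x => (G.weight x : ℂ)⁻¹ * G.val f x := by
      rw [memEll2_iff] at hf ⊢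
      refine (hf.add ((G.memEll2_iff _).1 f.2)).congr fun x => ?_
      rw [hn, norm_mul, norm_inv, Complex.norm_real, Real.norm_of_nonneg (G.weight_pos x).le,
        mul_pow, inv_pow, weight_sq, inv_inv]
      change _ + G.m x * ‖G.val f x‖ ^ 2 = _
      ring
    refine ⟨G.toEll2 _ hmem, G.val_injective (funext fun x => ?_)⟩
    have : (G.weight x : ℂ) ≠ 0 := by exact_mod_cast (G.weight_pos x).ne'
    rw [val_weightOp, val_toEll2, mul_inv_cancel_left₀ this]

end WeightedGraph

/-! ### Bounding the adjacency form by means of the decomposition. -/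

namespace WeightedGraph

variable {V : Type*} {G : WeightedGraph V}

namespace OneDimDecomposition

variable (S : G.OneDimDecomposition)

/-- The weight with which an edge between `x` and `y` contributes to `x`: an edge between adjacent
spheres is attributed mostly to its outer end if `θ < 1`. -/
def edgeShare (θ : ℝ) (x y : V) : ℝ :=
  (if S.level y = S.level x then 1 else 0) + (if S.level y = S.level x + 1 then θ else 0) +
    if S.level y + 1 = S.level x then θ⁻¹ else 0

theorem edgeShare_nonneg {θ : ℝ} (hθ : 0 < θ) (x y : V) : 0 ≤ S.edgeShare θ x y := by
  unfold edgeShare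
  positivity

/-- Reciprocal shares at the two ends are what `2ab ≤ s a² + s⁻¹ b²` requires. Neighbours differ by
at most one level, so exactly one case of the share applies. -/
theorem edgeShare_mul {θ : ℝ} (hθ : 0 < θ) {x y : V} (h : 0 < G.edge x y) :
    S.edgeShare θ x y * S.edgeShare θ y x = 1 := by
  have h1 := S.level_le x y h
  have h2 := S.level_le y x (G.edge_symm x y ▸ h)
  have hne : ∀ n : ℕ, n + 1 + 1 ≠ n := fun n => by omega
  unfold edgeShare
  rcases lt_trichotomy (S.level x) (S.level y) with hl | hl | hl
  · have e : S.level y = S.level x + 1 := by omega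
    simp [e, hne, (hne _).symm, hθ.ne']
  · simp [hl]
  · have e : S.level x = S.level y + 1 := by omega
    simp [e, hne, (hne _).symm, hθ.ne']

theorem sum_edge_mul_edgeShare (θ : ℝ) (x : V) :
    ∑ y ∈ G.nbrs x, G.edge x y * S.edgeShare θ x y =
      G.m x * (S.degZero x + θ * S.degPlus x + θ⁻¹ * S.degMinus x) := by
  have hm := (G.m_pos x).ne'
  simp only [edgeShare, mul_add, Finset.sum_add_distrib, mul_ite, mul_one, mul_zero]
  rw [degZero, degPlus, degMinus, Finset.sum_filter, Finset.sum_filter, Finset.sum_filter]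
  congr 1
  · congr 1
    · field_simp
    · rw [mul_left_comm, mul_div_cancel₀ _ hm, Finset.mul_sum]
      exact Finset.sum_congr rfl fun y _ => by split_ifs <;> ring
  · rw [mul_left_comm, mul_div_cancel₀ _ hm, Finset.mul_sum]
    exact Finset.sum_congr rfl fun y _ => by split_ifs <;> ring

theorem edge_mul_mul_le {θ : ℝ} (hθ : 0 < θ) (x y : V) (a b : ℝ) :
    G.edge x y * (a * b) ≤
      (G.edge x y * S.edgeShare θ x y * a ^ 2 + G.edge y x * S.edgeShare θ y x * b ^ 2) / 2 := by
  rcases (G.edge_nonneg x y).eq_or_lt with h | h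
  · rw [G.edge_symm y x, ← h]
    simp
  · rw [G.edge_symm y x]
    have h1 := S.edgeShare_mul hθ h
    have h2 := S.edgeShare_nonneg hθ x y
    have h3 : 0 < S.edgeShare θ x y := h2.lt_of_ne' fun h0 => by simp [h0] at h1
    have h4 : S.edgeShare θ y x = (S.edgeShare θ x y)⁻¹ := eq_inv_of_mul_eq_one_right h1
    have h5 : a * b ≤ (S.edgeShare θ x y * a ^ 2 + S.edgeShare θ y x * b ^ 2) / 2 := by
      rw [h4]
      have h6 : S.edgeShare θ x y * a ^ 2 + (S.edgeShare θ x y)⁻¹ * b ^ 2 - 2 * (a * b) =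
          (S.edgeShare θ x y)⁻¹ * (S.edgeShare θ x y * a - b) ^ 2 := by
        field_simp
        ring
      have h7 : 0 ≤ (S.edgeShare θ x y)⁻¹ * (S.edgeShare θ x y * a - b) ^ 2 := by positivity
      linarith
    calc _ ≤ _ := mul_le_mul_of_nonneg_left h5 h.le
      _ = _ := by ring

/-- Each edge is split between its ends; exchanging `x` and `y` shows that the two halves have equal
sums. -/
theorem sum_edge_mul_mul_le {θ : ℝ} (hθ : 0 < θ) (s : Finset V) (u : V → ℝ) :
    ∑ x ∈ s, ∑ y ∈ s, G.edge x y * (u x * u y) ≤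
      ∑ x ∈ s, G.m x * (S.degZero x + θ * S.degPlus x + θ⁻¹ * S.degMinus x) * u x ^ 2 := by
  have h1 : ∑ x ∈ s, ∑ y ∈ s, G.edge x y * (u x * u y) ≤
      ∑ x ∈ s, ∑ y ∈ s, G.edge x y * S.edgeShare θ x y * u x ^ 2 := by
    have h2 : ∑ x ∈ s, ∑ y ∈ s, G.edge y x * S.edgeShare θ y x * u y ^ 2 =
      ∑ x ∈ s, ∑ y ∈ s, G.edge x y * S.edgeShare θ x y * u x ^ 2 := Finset.sum_comm
    have h3 := Finset.sum_le_sum fun x (_ : x ∈ s) => Finset.sum_le_sum fun y (_ : y ∈ s) =>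
      S.edge_mul_mul_le hθ x y (u x) (u y)
    simp only [← Finset.sum_div, Finset.sum_add_distrib] at h3
    linarith
  refine h1.trans (Finset.sum_le_sum fun x _ => ?_)
  rw [← Finset.sum_mul, ← sum_edge_mul_edgeShare]
  exact mul_le_mul_of_nonneg_right (G.sum_edge_mul_le x s (S.edgeShare_nonneg hθ x)) (sq_nonneg _)

theorem degPlus_le_deg (x : V) : S.degPlus x ≤ G.deg x :=
  div_le_div_of_nonneg_right (Finset.sum_le_sum_of_subset_of_nonneg (Finset.filter_subset _ _)
    fun y _ _ => G.edge_nonneg x y) (G.m_pos x).le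

theorem degPlus_nonneg (x : V) : 0 ≤ S.degPlus x :=
  div_nonneg (Finset.sum_nonneg fun y _ => G.edge_nonneg x y) (G.m_pos x).le

/-- Balls are finite unions of finite spheres, so what holds for large `|x|` holds off a finite set.
-/
theorem cofinite_le_atInfinity : cofinite ≤ S.atInfinity := by
  refine Tendsto.le_comap ?_
  rw [tendsto_atTop]
  intro n
  rw [eventually_cofinite]
  refine ((Set.finite_lt_nat n).biUnion fun k _ => S.finite_sphere k).subset fun x hx => ?_
  exact Set.mem_biUnion (x := S.level x) (not_le.1 hx) rfl

variable {S}

theorem exists_deg_bound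
    (hsmall : (fun x => max (S.degMinus x) (S.degZero x)) =o[S.atInfinity] S.degPlus)
    {ε : ℝ} (hε : 0 < ε) :
    ∃ θ > 0, ∃ C, ∀ x,
      S.degZero x + θ * S.degPlus x + θ⁻¹ * S.degMinus x ≤ ε * (G.deg x + 1) + C := by
  -- Each of the three terms will be at most `θ * degPlus` off a finite set, whose contribution goes
  -- into `C`.
  set θ := ε / 3 with hθ
  have hθ0 : 0 < θ := by positivity
  refine ⟨θ, hθ0, ?_⟩
  -- The bound `θ` serves `degZero`; `θ * θ` serves `degMinus`, which carries the factor `θ⁻¹`.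
  set η := min θ (θ * θ) with hη
  have hη0 : 0 < η := lt_min hθ0 (mul_pos hθ0 hθ0)
  have hfin := eventually_cofinite.1
    ((isLittleO_iff.1 (hsmall.mono S.cofinite_le_atInfinity)) hη0)
  obtain ⟨C, hC⟩ := (hfin.image fun x =>
    S.degZero x + θ * S.degPlus x + θ⁻¹ * S.degMinus x).bddAbove
  refine ⟨max C 0, fun x => ?_⟩
  have hd : 0 ≤ ε * (G.deg x + 1) := mul_nonneg hε.le (G.deg_add_one_pos x).le
  by_cases hx : ‖max (S.degMinus x) (S.degZero x)‖ ≤ η * ‖S.degPlus x‖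
  · have hp := S.degPlus_nonneg x
    rw [Real.norm_of_nonneg hp] at hx
    have h1 := (le_abs_self _).trans hx
    have h2 : S.degZero x ≤ θ * S.degPlus x := ((le_max_right _ _).trans h1).trans
      (mul_le_mul_of_nonneg_right (min_le_left _ _) hp)
    have h3 : S.degMinus x ≤ θ * (θ * S.degPlus x) := by
      rw [← mul_assoc]
      exact ((le_max_left _ _).trans h1).trans (mul_le_mul_of_nonneg_right (min_le_right _ _) hp)
    have h4 : θ⁻¹ * S.degMinus x ≤ θ * S.degPlus x := (inv_mul_le_iff₀ hθ0).2 h3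
    have h5 := mul_le_mul_of_nonneg_left (S.degPlus_le_deg x) hε.le
    have h6 : θ * S.degPlus x = ε * S.degPlus x / 3 := by rw [hθ]; ring
    linarith [le_max_right C 0]
  · have := hC ⟨x, hx, rfl⟩
    dsimp only at this
    linarith [le_max_left C 0]

/-- `T - 1` is minus the normalized adjacency operator, whose form at `g` is the adjacency form at
`W g`. The factor `deg + 1` in its bound turns `|W g|²` back into `|g|²`. -/
theorem normLap_close
    (hsmall : (fun x => max (S.degMinus x) (S.degZero x)) =o[S.atInfinity] S.degPlus)
    {ε : ℝ} (hε : 0 < ε) :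
    ∃ C, ∀ g, |(inner ℂ g (G.normLap g)).re - ‖g‖ ^ 2| ≤
      ε * ‖g‖ ^ 2 + C * ‖G.weightOp g‖ ^ 2 := by
  classical
  obtain ⟨θ, hθ, C, hC⟩ := exists_deg_bound hsmall hε
  refine ⟨C, fun g => G.dense_finSupp.induction (P := fun g =>
    |(inner ℂ g (G.normLap g)).re - ‖g‖ ^ 2| ≤ ε * ‖g‖ ^ 2 + C * ‖G.weightOp g‖ ^ 2)
    (fun g hg => ?_) (isClosed_le ((Complex.continuous_re.comp (by fun_prop)).sub
      (by fun_prop)).abs (by fun_prop)) g⟩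
  set s := Set.Finite.toFinset hg
  have hs := G.val_eq_zero_of_notMem hg (Finset.Subset.refl s)
  have hs' : ∀ x ∉ s, G.val (G.weightOp g) x = 0 := fun x hx => by
    rw [val_weightOp, hs x hx, mul_zero]
  have hsum : ∀ f : G.Ell2, (∀ x ∉ s, G.val f x = 0) →
      ‖f‖ ^ 2 = ∑ x ∈ s, G.m x * ‖G.val f x‖ ^ 2 := fun f hf => by
    rw [norm_sq_eq]
    exact tsum_eq_sum fun x hx => by rw [hf x hx]; simp
  have h1 : (inner ℂ g (G.normLap g)).re - ‖g‖ ^ 2 = -(inner ℂ g (G.adjOp g)).re := by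
    have h2 : (inner ℂ g g).re = ‖g‖ ^ 2 := inner_self_eq_norm_sq (𝕜 := ℂ) g
    rw [normLap_apply, inner_sub_right, Complex.sub_re, h2]
    ring
  rw [h1, abs_neg]
  calc _ ≤ ‖inner ℂ g (G.adjOp g)‖ := Complex.abs_re_le_norm _
    _ ≤ ∑ x ∈ s, ∑ y ∈ s, G.edge x y *
          (‖G.val (G.weightOp g) x‖ * ‖G.val (G.weightOp g) y‖) := by
        rw [G.inner_adjOp g g s hs hs]
        refine (norm_sum_le _ _).trans (Finset.sum_le_sum fun x _ => (norm_sum_le _ _).trans_eq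
          (Finset.sum_congr rfl fun y _ => ?_))
        rw [norm_mul, norm_mul, Complex.norm_real, Real.norm_of_nonneg (G.edge_nonneg x y),
          RCLike.norm_conj]
    _ ≤ _ := S.sum_edge_mul_mul_le hθ s _
    _ ≤ ∑ x ∈ s, (ε * (G.m x * ‖G.val g x‖ ^ 2) +
          C * (G.m x * ‖G.val (G.weightOp g) x‖ ^ 2)) := by
        refine Finset.sum_le_sum fun x _ => ?_
        have hm := G.m_pos x
        have e : ‖G.val g x‖ ^ 2 = (G.deg x + 1) * ‖G.val (G.weightOp g) x‖ ^ 2 := by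
          rw [val_weightOp, norm_mul, Complex.norm_real,
            Real.norm_of_nonneg (G.weight_pos x).le, mul_pow, weight_sq,
            mul_inv_cancel_left₀ (G.deg_add_one_pos x).ne']
        rw [e]
        calc _ ≤ G.m x * (ε * (G.deg x + 1) + C) * ‖G.val (G.weightOp g) x‖ ^ 2 :=
              mul_le_mul_of_nonneg_right (mul_le_mul_of_nonneg_left (hC x) hm.le) (sq_nonneg _)
          _ = _ := by ring
    _ = _ := by
        rw [Finset.sum_add_distrib, ← Finset.mul_sum, ← Finset.mul_sum, ← hsum g hs,
          ← hsum _ hs']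

theorem isCoercive
    (hsmall : (fun x => max (S.degMinus x) (S.degZero x)) =o[S.atInfinity] S.degPlus) :
    G.IsCoercive := by
  obtain ⟨C, hC⟩ := normLap_close hsmall (ε := 1 / 2) (by norm_num)
  -- From `‖g‖ ^ 2 / 2 ≤ ⟪g, T g⟫ + C ‖W g‖ ^ 2` and `‖W g‖ ^ 2 ≤ ⟪g, T g⟫`.
  refine ⟨(2 * (1 + |C|))⁻¹, by positivity, fun g => ?_⟩
  rw [inv_mul_le_iff₀ (by positivity)]
  have h1 := (abs_le.1 (hC g)).1
  have h2 := mul_le_mul_of_nonneg_left (G.norm_weightOp_sq_le g) (abs_nonneg C)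
  have h3 := mul_le_mul_of_nonneg_right (le_abs_self C) (sq_nonneg ‖G.weightOp g‖)
  linarith

end OneDimDecomposition

end WeightedGraph

end

/-! ### Conclusion. -/

theorem theoremt {V : Type*} [Countable V] [Nonempty V] (G : WeightedGraph V)
    (S : G.OneDimDecomposition)
    (hplus : Tendsto S.degPlus S.atInfinity atTop)
    (hsmall : (fun x => max (S.degMinus x) (S.degZero x)) =o[S.atInfinity] S.degPlus) :
    G.laplacian.formDomain = (G.mulOp fun x => Real.sqrt (G.deg x)).domain ∧
    G.laplacian.essSpectrum = ∅ ∧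
    ∃ l k : ℕ → ℝ,
      G.laplacian.IsEigenvalueSequence l ∧
      (G.mulOp G.deg).IsEigenvalueSequence k ∧
      Tendsto (fun n => l n / k n) atTop (𝓝 1) := by
  have hG := WeightedGraph.OneDimDecomposition.isCoercive hsmall
  have hdeg : Tendsto G.deg cofinite atTop :=
    tendsto_atTop_mono S.degPlus_le_deg (hplus.mono_left S.cofinite_le_atInfinity)
  have hfin : ∀ t, {x | G.deg x ≤ t}.Finite := fun t => by
    simpa using eventually_cofinite.1 (hdeg.eventually_gt_atTop t)
  have : Infinite V := Set.infinite_univ_iff.1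
    ((G.infinite_component (Classical.arbitrary V)).mono (Set.subset_univ _))
  -- Listing the vertices by increasing degree gives both the eigenvalues of `deg(·)` and the basis
  -- for the comparison.
  obtain ⟨e, he⟩ := exists_equiv_monotone_comp G.deg hfin
  have hpert : G.laplacian.IsDiagonalPerturbation (G.deltaBasis.reindex e) (G.deg ∘ e)
      G.weightOp G.normLap :=
    { k_nonneg := fun n => G.deg_nonneg _
      k_mono := he
      k_tendsto := hdeg.comp (Nat.cofinite_eq_atTop ▸ e.injective.tendsto_cofinite)
      inner_W := fun f n => by
        rw [HilbertBasis.reindex_apply]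
        exact G.inner_weightOp f (e n)
      T_symm := G.normLap_symm
      T_coercive := hG
      T_close := fun ε hε => WeightedGraph.OneDimDecomposition.normLap_close hsmall hε
      graph := WeightedGraph.laplacian_graph hG
      mem_domain := fun n => by
        rw [HilbertBasis.reindex_apply, G.deltaBasis_apply]
        exact (WeightedGraph.minLaplacian_le_laplacian hG).1 (G.delta_mem_finSupp (e n)) }
  obtain ⟨hess, l, hl, hlim⟩ := hpert.exists_isEigenvalueSequence
  exact ⟨(WeightedGraph.formDomain_laplacian hG).trans G.range_weightOp, hess, l, G.deg ∘ e, hl,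
    (G.mulOp_isDiagonal G.deg).isEigenvalueSequence hfin e he, hlim⟩
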